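/- **Setting.** *Grigorchuk's group* $G$ is the group generated by the four automorphisms $a,b,c,d$ of the rooted binary tree (vertex set: the finite words over $\{0,1\}$) given by $a(0w)=1w$, $a(1w)=0w$; $b(0w)=0a(w)$, $b(1w)=1c(w)$; $c(0w)=0a(w)$, $c(1w)=1d(w)$; $d(0w)=0w$, $d(1w)=1b(w)$, all fixing the empty word. It acts on the boundary $\partial\mathcal T=\{0,1\}^{\mathbb N}$ through finite prefixes. Let $\mathcal G_*$ be the set of isomorphism classes of rooted, connected, locally finite, undirected graphs with edges labeled by $a,b,c,d$ (loops and several edges with distinct labels between the same vertices are allowed), with the topology of local convergence: basic open sets consist of the classes whose ball of a given radius around the root is isomorphic, as a rooted labeled graph, to that of a given class. For $\xi\in\partial\mathcal T$ let $\Gamma_\xi$ be the orbital Schreier graph with vertex set $G\xi$ and an edge labeled $s\in\{a,b,c,d\}$ between $u$ and $v$ iff $su=v$, and let $\mathcal F(\xi)\in\mathcal G_*$ be the class of $(\Gamma_\xi,\xi)$. The *space of Schreier graphs* $X$ is the closure $\overline{\mathcal F(\partial\mathcal T)}$ in $\mathcal G_*$ without the isolated points of this closure. The group $G$ acts on $X$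 by homeomorphisms by changing the root: the generator $s$ moves the root along the edge labeled $s$. Let $\mathcal A=\{a,x,y,z\}$ and let $\tau$ be the substitution $a\mapsto axa$, $x\mapsto y$, $y\mapsto z$, $z\mapsto x$. Let $\Omega_\tau\subset\mathcal A^{\mathbb Z}$ be the subshift of all $\omega$ each of whose finite subwords occurs in some $\tau^n(s)$, $s\in\mathcal A$, $n\ge 0$, with the product topology and the shift $(T\omega)(n)=\omega(n+1)$. In every $\omega\in\Omega_\tau$ exactly one of two consecutive letters is $a$. Put $S_a=\{a\}$, $S_b=\{x,y\}$, $S_c=\{x,z\}$, $S_d=\{y,z\}$. For $s\in\{a,b,c,d\}$ define the map $\delta_s:\Omega_\tau\to\Omega_\tau$ by $\delta_s\omega=T\omega$ if $\omega_1\in S_s$, $\delta_s\omega=T^{-1}\omega$ if $\omega_0\in S_s$, and $\delta_s\omega=\omega$ otherwise; write $A,B,C,D$ for $\delta_a,\delta_b,\delta_c,\delta_d$. These are homeomorphisms and involutions; let $H$ be the group they generate in the group of homeomorphisms of $\Omega_\tau$. For $\omega\in\Omega_\tau$ let $\mathrm{Graph}(\omega)\in\mathcal G_*$ be the class of the following labeled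 graph with vertex set $\mathbb Z$ and root $1$: for each $n$, if $\omega_n=a$ there is an edge labeled $a$ between $n$ and $n+1$; if $\omega_n=x$ (respectively $y$, $z$) there are two edges between $n$ and $n+1$, labeled $b,c$ (respectively $b,d$; $c,d$), and both $n$ and $n+1$ carry a loop labeled $d$ (respectively $c$; $b$). **Theorem (Factor theorem).** \label{Main-connection} (a) There is a group isomorphism $\varrho:G\to H$ with $\varrho(a)=A$, $\varrho(b)=B$, $\varrho(c)=C$, $\varrho(d)=D$. In particular $\alpha_g(\omega):=\varrho(g)(\omega)$ defines an action $\alpha$ of $G$ on $\Omega_\tau$ by homeomorphisms. (b) The dynamical system $(X,G)$ is a factor of $(\Omega_\tau,G)$ via $\psi:\Omega_\tau\to X$, $\omega\mapsto\mathrm{Graph}(\omega)$: this map is well defined (takes its values in $X$), continuous, surjective and satisfies $\psi(\alpha_g\omega)=g\,\psi(\omega)$ for all $g\in G$, $\omega\in\Omega_\tau$. It is two-to-one, i.e. every point of $X$ has exactly two preimages. (c) For every $\omega\in\Omega_\tau$ the orbits $\{T^n\omega:n\in\mathbb Z\}$ and $\{\alpha_g(\omega):g\in G\}$ coincide. (d)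 The system $(\Omega_\tau,G)$ is uniquely ergodic, and its unique $G$-invariant Borel probability measure coincides with the unique $T$-invariant Borel probability measure on $\Omega_\tau$. -/

import Mathlib

open Set Filter Topology MeasureTheory

noncomputable section

namespace Grig

/-! ### The rooted binary tree, its boundary, and Grigorchuk's group -/

/-- The labels `a, b, c, d` (names of the four generators). -/
inductive Gen
  | a | b | c | d
  deriving DecidableEq

/-- The automorphism group of the rooted binary tree. Vertices are the finite words over `{0,1}`
(`false` is `0`, `true` is `1`, the root is the empty word); automorphisms are the permutations of
the vertices that preserve the level and the prefix relation. -/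
def treeAut : Subgroup (Equiv.Perm (List Bool)) where
  carrier := {g | (∀ w, (g w).length = w.length) ∧ ∀ w n, g (w.take n) = (g w).take n}
  one_mem' := ⟨fun _ => rfl, fun _ _ => rfl⟩
  mul_mem' := by
    rintro g h ⟨hg, hg'⟩ ⟨hh, hh'⟩
    exact ⟨fun w => by simp [hg, hh], fun w n => by simp [hg', hh']⟩
  inv_mem' := by
    rintro g ⟨hg, hg'⟩
    refine ⟨fun w => ?_, fun w n => ?_⟩
    · rw [← hg (g⁻¹ w)]; simp
    · apply g.injective
      rw [hg']; simp

/-- The four generators acting on words: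
`a(0w) = 1w`, `a(1w) = 0w`; `b(0w) = 0a(w)`, `b(1w) = 1c(w)`;
`c(0w) = 0a(w)`, `c(1w) = 1d(w)`; `d(0w) = 0w`, `d(1w) = 1b(w)`. -/
def genFun : Gen → List Bool → List Bool
  | _, [] => []
  | .a, false :: w => true :: w
  | .a, true :: w => false :: w
  | .b, false :: w => false :: genFun .a w
  | .b, true :: w => true :: genFun .c w
  | .c, false :: w => false :: genFun .a w
  | .c, true :: w => true :: genFun .d w
  | .d, false :: w => false :: w
  | .d, true :: w => true :: genFun .b w

theorem genFun_invol (s : Gen) (w : List Bool) : genFun s (genFun s w) = w := by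
  induction w generalizing s with
  | nil => cases s <;> rfl
  | cons i w ih => cases s <;> cases i <;> simp [genFun, ih]

theorem genFun_length (s : Gen) (w : List Bool) : (genFun s w).length = w.length := by
  induction w generalizing s with
  | nil => cases s <;> rfl
  | cons i w ih => cases s <;> cases i <;> simp [genFun, ih]

theorem genFun_take (s : Gen) (w : List Bool) (n : ℕ) :
    genFun s (w.take n) = (genFun s w).take n := by
  induction w generalizing s n with
  | nil => cases s <;> simp [genFun]
  | cons i w ih =>
    cases n with
    | zero => cases s <;> simp [genFun]
    | succ n => cases s <;> cases i <;> simp [genFun, ih]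

/-- The generators as automorphisms of the rooted binary tree. -/
def gen (s : Gen) : treeAut :=
  ⟨Function.Involutive.toPerm (genFun s) (genFun_invol s), genFun_length s, genFun_take s⟩

/-- Grigorchuk's group, generated by `a, b, c, d` in the automorphism group of the tree. -/
def grigorchuk : Subgroup treeAut := Subgroup.closure (range gen)

/-- A generator as an element of Grigorchuk's group. -/
def gGen (s : Gen) : grigorchuk := ⟨gen s, Subgroup.subset_closure (mem_range_self s)⟩

/-- The boundary of the tree: one-sided infinite words over `{0,1}`. -/
abbrev Boundary : Type := ℕ → Bool

/-- The first `n` letters of a boundary point. -/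
def initial (ξ : Boundary) (n : ℕ) : List Bool := (List.range n).map ξ

/-- A tree automorphism acts on the boundary through its action on the finite prefixes. -/
def boundaryMap (g : treeAut) (ξ : Boundary) : Boundary :=
  fun n => (g.1 (initial ξ (n + 1))).getD n false

theorem initial_take (ξ : Boundary) {m n : ℕ} (h : m ≤ n) :
    (initial ξ n).take m = initial ξ m := by
  simp [initial, ← List.map_take, List.take_range, h]

theorem initial_boundaryMap (g : treeAut) (ξ : Boundary) (n : ℕ) :
    initial (boundaryMap g ξ) n = g.1 (initial ξ n) := by
  have hlen : (g.1 (initial ξ n)).length = n := by rw [g.2.1]; simp [initial]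
  apply List.ext_getElem
  · rw [hlen]; simp [initial]
  · intro i h₁ h₂
    have hi : i < n := hlen ▸ h₂
    have h : g.1 (initial ξ (i + 1)) = (g.1 (initial ξ n)).take (i + 1) := by
      rw [← g.2.2, initial_take ξ hi]
    simp only [initial, List.getElem_map, List.getElem_range, boundaryMap]
    change (g.1 (initial ξ (i + 1))).getD i false = _
    rw [h, List.getD_eq_getElem _ _ (by simp [h₂])]
    simp [initial]

instance boundaryAction : MulAction treeAut Boundary where
  smul := boundaryMap
  one_smul ξ := by
    funext n
    change (initial ξ (n + 1)).getD n false = ξ n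
    simp [initial]
  mul_smul g h ξ := by
    funext n
    change (g.1 (h.1 (initial ξ (n + 1)))).getD n false
      = (g.1 (initial (boundaryMap h ξ) (n + 1))).getD n false
    rw [initial_boundaryMap]

/-! ### The space of rooted labeled graphs -/

/-- Rooted, connected, locally finite, undirected graphs whose edges are labeled by `a, b, c, d`
(loops are allowed, and so are several edges with distinct labels between the same vertices). -/
structure RootedGraph where
  V : Type
  Adj : Gen → V → V → Prop
  symm : ∀ s u v, Adj s u v → Adj s v u
  root : V
  connected : ∀ v, Relation.ReflTransGen (fun u w => ∃ s, Adj s u w) root v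
  locallyFinite : ∀ v, {w | ∃ s, Adj s v w}.Finite

namespace RootedGraph

/-- Isomorphism of rooted labeled graphs. -/
def Iso (Γ Δ : RootedGraph) : Prop :=
  ∃ e : Γ.V ≃ Δ.V, e Γ.root = Δ.root ∧ ∀ s u v, Γ.Adj s u v ↔ Δ.Adj s (e u) (e v)

/-- The vertices at distance at most `n` from the root. -/
def ball (Γ : RootedGraph) : ℕ → Set Γ.V
  | 0 => {Γ.root}
  | n + 1 => {v | v ∈ Γ.ball n ∨ ∃ u ∈ Γ.ball n, ∃ s, Γ.Adj s u v}

/-- The balls of radius `n` around the roots are isomorphic as rooted labeled graphs. -/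
def BallIso (n : ℕ) (Γ Δ : RootedGraph) : Prop :=
  ∃ e : Γ.ball n ≃ Δ.ball n, (∀ u : Γ.ball n, (u : Γ.V) = Γ.root ↔ (e u : Δ.V) = Δ.root) ∧
    ∀ (s : Gen) (u v : Γ.ball n), Γ.Adj s (u : Γ.V) v ↔ Δ.Adj s (e u : Δ.V) (e v)

/-- The same graph with another root. -/
def reroot (Γ : RootedGraph) (v : Γ.V) : RootedGraph where
  V := Γ.V
  Adj := Γ.Adj
  symm := Γ.symm
  root := v
  connected w := by
    have hs : Std.Symm (fun u w : Γ.V => ∃ s, Γ.Adj s u w) :=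
      ⟨fun u w ⟨s, h⟩ => ⟨s, Γ.symm s u w h⟩⟩
    exact (Relation.ReflTransGen.stdSymm.symm _ _ (Γ.connected v)).trans (Γ.connected w)
  locallyFinite := Γ.locallyFinite

instance setoid : Setoid RootedGraph where
  r := Iso
  iseqv :=
    { refl := fun Γ => ⟨Equiv.refl _, rfl, fun _ _ _ => Iff.rfl⟩
      symm := by
        rintro Γ Δ ⟨e, h, h'⟩
        exact ⟨e.symm, by simp [← h], fun s u v => by simp [h']⟩
      trans := by
        rintro Γ Δ Λ ⟨e, h, h'⟩ ⟨f, k, k'⟩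
        exact ⟨e.trans f, by simp [h, k], fun s u v => by simp [h', k']⟩ }

end RootedGraph

/-- Isomorphism classes of rooted labeled graphs. -/
def GraphSpace : Type 1 := Quotient RootedGraph.setoid

/-- The isomorphism class of a rooted labeled graph. -/
def cls (Γ : RootedGraph) : GraphSpace := Quotient.mk _ Γ

/-- Two classes agree up to radius `n` if the `n`-balls around the roots are isomorphic. -/
def AgreeUpTo (n : ℕ) (x y : GraphSpace) : Prop :=
  ∃ Γ Δ : RootedGraph, cls Γ = x ∧ cls Δ = y ∧ RootedGraph.BallIso n Γ Δ

/-- The topology of local convergence: the classes that agree with a given one up to a given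
radius form the basic open sets. -/
instance graphTopology : TopologicalSpace GraphSpace :=
  TopologicalSpace.generateFrom {U | ∃ x n, U = {y | AgreeUpTo n x y}}

/-- `y` arises from `x` by moving the root along an edge with label `s`. -/
def MovesRoot (s : Gen) (x y : GraphSpace) : Prop :=
  ∃ (Γ : RootedGraph) (v : Γ.V), Γ.Adj s Γ.root v ∧ x = cls Γ ∧ y = cls (Γ.reroot v)

/-! ### Orbital Schreier graphs and the space `X` -/

theorem schreier_connected (ξ : Boundary) (g : grigorchuk)
    (h : g • ξ ∈ MulAction.orbit grigorchuk ξ) :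
    Relation.ReflTransGen
      (fun u w : MulAction.orbit grigorchuk ξ => ∃ s, gGen s • (u : Boundary) = w)
      ⟨ξ, MulAction.mem_orbit_self ξ⟩ ⟨g • ξ, h⟩ := by
  obtain ⟨g, hg⟩ := g
  induction hg using Subgroup.closure_induction_left with
  | one =>
    have : (⟨ξ, MulAction.mem_orbit_self ξ⟩ : MulAction.orbit grigorchuk ξ)
        = ⟨(⟨1, Subgroup.one_mem _⟩ : grigorchuk) • ξ, h⟩ :=
      Subtype.ext (one_smul treeAut ξ).symm
    rw [← this]
  | mul_left x hx y hy ih =>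
    obtain ⟨s, rfl⟩ := hx
    exact (ih (MulAction.mem_orbit ξ (⟨y, hy⟩ : grigorchuk))).tail
      ⟨s, (mul_smul (gen s) y ξ).symm⟩
  | inv_mul_cancel x hx y hy ih =>
    obtain ⟨s, rfl⟩ := hx
    refine (ih (MulAction.mem_orbit ξ (⟨y, hy⟩ : grigorchuk))).tail ⟨s, ?_⟩
    have : (gen s)⁻¹ = gen s := by
      rw [inv_eq_iff_mul_eq_one]
      exact Subtype.ext (Equiv.ext (genFun_invol s))
    change gen s • y • ξ = ((gen s)⁻¹ * y) • ξ
    rw [this, mul_smul]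

theorem gGen_smul_smul (s : Gen) (ξ : Boundary) : gGen s • gGen s • ξ = ξ := by
  have : gGen s * gGen s = 1 := Subtype.ext (Subtype.ext (Equiv.ext (genFun_invol s)))
  rw [← mul_smul, this, one_smul]

/-- The orbital Schreier graph of a boundary point `ξ`, rooted at `ξ`: the vertices are the points
of the orbit of `ξ`, and there is an edge with label `s` between `u` and `v` iff `s u = v`. -/
def schreier (ξ : Boundary) : RootedGraph where
  V := MulAction.orbit grigorchuk ξ
  Adj s u v := gGen s • (u : Boundary) = v
  symm s u v h := by rw [← h, gGen_smul_smul]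
  root := ⟨ξ, MulAction.mem_orbit_self ξ⟩
  connected := by
    rintro ⟨_, g, rfl⟩
    exact schreier_connected ξ g _
  locallyFinite v := by
    have : Finite Gen := Finite.of_surjective
      (fun i : Fin 4 => match i with | 0 => Gen.a | 1 => Gen.b | 2 => Gen.c | 3 => Gen.d)
      (fun s => by cases s; exacts [⟨0, rfl⟩, ⟨1, rfl⟩, ⟨2, rfl⟩, ⟨3, rfl⟩])
    refine (Set.finite_range (fun s : Gen => (⟨gGen s • (v : Boundary),
      MulAction.mem_orbit_of_mem_orbit _ v.2⟩ : MulAction.orbit grigorchuk ξ))).subset ?_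
    rintro w ⟨s, hs⟩
    exact ⟨s, Subtype.ext hs⟩

/-- The closure of the set of (classes of) rooted orbital Schreier graphs. -/
def schreierClosure : Set GraphSpace := closure (range fun ξ : Boundary => cls (schreier ξ))

/-- The space of Schreier graphs: the closure above without its isolated points. -/
def X : Set GraphSpace :=
  {x ∈ schreierClosure | ¬ ∃ U : Set GraphSpace, IsOpen U ∧ U ∩ schreierClosure = {x}}

/-! ### The substitution `τ` and its two-sided subshift -/

/-- The alphabet `{a, x, y, z}`. -/
inductive Letter
  | a | x | y | z
  deriving DecidableEq

instance letterTopology : TopologicalSpace Letter := ⊥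
instance letterDiscrete : DiscreteTopology Letter := ⟨rfl⟩
instance letterMeasurable : MeasurableSpace Letter := ⊤
instance letterFinite : Finite Letter := Finite.of_surjective
  (fun i : Fin 4 => match i with | 0 => Letter.a | 1 => Letter.x | 2 => Letter.y | 3 => Letter.z)
  (fun s => by cases s; exacts [⟨0, rfl⟩, ⟨1, rfl⟩, ⟨2, rfl⟩, ⟨3, rfl⟩])
instance letterBorel : BorelSpace Letter := ⟨borel_eq_top_of_discrete.symm⟩

/-- The substitution on letters: `a ↦ axa`, `x ↦ y`, `y ↦ z`, `z ↦ x`. -/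
def tauLetter : Letter → List Letter
  | .a => [.a, .x, .a]
  | .x => [.y]
  | .y => [.z]
  | .z => [.x]

/-- The substitution on finite words. -/
def tau (w : List Letter) : List Letter := w.flatMap tauLetter

/-- The finite words occurring in some `τ^n(s)`, `s` a letter. -/
def subTau : Set (List Letter) := {w | ∃ (s : Letter) (n : ℕ), w <:+: tau^[n] [s]}

/-- The word `ω_m ω_{m+1} … ω_{m+k-1}`. -/
def subword (ω : ℤ → Letter) (m : ℤ) (k : ℕ) : List Letter :=
  (List.range k).map fun i => ω (m + i)

/-- The subshift of `τ`: two-sided sequences all of whose finite subwords occur in some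
`τ^n(s)`. -/
def omegaTau : Set (ℤ → Letter) := {ω | ∀ m k, subword ω m k ∈ subTau}

/-- The shift `(Tω)(n) = ω(n+1)` as a homeomorphism of the subshift. -/
def shift : omegaTau ≃ₜ omegaTau where
  toFun ω := ⟨fun n => ω.1 (n + 1), fun m k => by
    have h := ω.2 (m + 1) k
    have e : subword (fun n => ω.1 (n + 1)) m k = subword ω.1 (m + 1) k := by
      unfold subword; congr 1; funext i; exact congrArg ω.1 (by ring)
    rwa [e]⟩
  invFun ω := ⟨fun n => ω.1 (n - 1), fun m k => by
    have h := ω.2 (m - 1) k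
    have e : subword (fun n => ω.1 (n - 1)) m k = subword ω.1 (m - 1) k := by
      unfold subword; congr 1; funext i; exact congrArg ω.1 (by ring)
    rwa [e]⟩
  left_inv ω := by ext n; simp
  right_inv ω := by ext n; simp
  continuous_toFun := by
    refine Continuous.subtype_mk (f := fun (ω : omegaTau) (n : ℤ) => ω.1 (n + 1)) ?_ _
    exact continuous_pi fun n => (continuous_apply (n + 1)).comp continuous_subtype_val
  continuous_invFun := by
    refine Continuous.subtype_mk (f := fun (ω : omegaTau) (n : ℤ) => ω.1 (n - 1)) ?_ _
    exact continuous_pi fun n => (continuous_apply (n - 1)).comp continuous_subtype_val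

theorem shift_apply (ω : omegaTau) (n : ℤ) : (shift ω).1 n = ω.1 (n + 1) := rfl

theorem shift_symm_apply (ω : omegaTau) (n : ℤ) : (shift.symm ω).1 n = ω.1 (n - 1) := rfl

/-! ### The alternation of `a` with the other letters -/

/-- Exactly one of the two letters is `a`. -/
def Alt (u v : Letter) : Prop := u = .a ↔ v ≠ .a

theorem tau_alt (w : List Letter) (h : w.IsChain Alt) : (tau w).IsChain Alt := by
  induction w with
  | nil => simp [tau]
  | cons u w ih =>
    have hw := ih h.tail
    have e : tau (u :: w) = tauLetter u ++ tau w := by simp [tau]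
    rw [e, List.isChain_append]
    refine ⟨by cases u <;> simp [tauLetter, Alt], hw, ?_⟩
    cases w with
    | nil => simp [tau]
    | cons v w =>
      have huv : Alt u v := by simp at h; exact h.1
      intro p hp q hq
      have e' : tau (v :: w) = tauLetter v ++ tau w := by simp [tau]
      rw [e'] at hq
      cases u <;> cases v <;> simp_all [tauLetter, Alt] <;> subst hp <;> subst hq <;> simp

theorem omegaTau_alt (ω : omegaTau) (n : ℤ) : Alt (ω.1 n) (ω.1 (n + 1)) := by
  obtain ⟨s, k, hk⟩ := ω.2 n 2
  have hc : ∀ k, (tau^[k] [s]).IsChain Alt := by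
    intro k
    induction k with
    | zero => simp
    | succ k ih => rw [Function.iterate_succ_apply']; exact tau_alt _ ih
  have := (hc k).infix hk
  simpa [subword, List.range_succ] using this

/-! ### The local moves `A, B, C, D` and the group `H` -/

/-- The labels of the edges encoded by a letter: `x, y, z` stand for the pairs `(b,c)`, `(b,d)`,
`(c,d)`, and `a` stands for itself. -/
def edgeLabels : Letter → Set Gen
  | .a => {.a}
  | .x => {.b, .c}
  | .y => {.b, .d}
  | .z => {.c, .d}

/-- The label of the loops at both end points of the edges encoded by a letter: `d, c, b` for
`x, y, z`, and none for `a`. -/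
def loopLabels : Letter → Set Gen
  | .a => ∅
  | .x => {.d}
  | .y => {.c}
  | .z => {.b}

open Classical in
/-- The maps `A, B, C, D` (for `s = a, b, c, d`). The map shifts by `T` if `ω_1` belongs to
`{a}`, `{x,y}`, `{x,z}`, `{y,z}` respectively, by `T⁻¹` if `ω_0` belongs to that set, and fixes
`ω` in all other cases. -/
def moveFun (s : Gen) (ω : omegaTau) : omegaTau :=
  if s ∈ edgeLabels (ω.1 1) then shift ω
  else if s ∈ edgeLabels (ω.1 0) then shift.symm ω
  else ω

theorem edge_disjoint {u v : Letter} (h : Alt u v) (s : Gen) (hu : s ∈ edgeLabels u) :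
    s ∉ edgeLabels v := by
  cases u <;> cases v <;> cases s <;> simp_all [edgeLabels, Alt]

theorem moveFun_invol (s : Gen) : Function.Involutive (moveFun s) := by
  intro ω
  by_cases h1 : s ∈ edgeLabels (ω.1 1)
  · have e : moveFun s ω = shift ω := by simp [moveFun, h1]
    have h2 : s ∉ edgeLabels ((shift ω).1 1) := by
      rw [shift_apply]; exact edge_disjoint (omegaTau_alt ω 1) s h1
    have h3 : s ∈ edgeLabels ((shift ω).1 0) := by rw [shift_apply]; simpa using h1
    rw [e]; simp [moveFun, h2, h3]
  · by_cases h0 : s ∈ edgeLabels (ω.1 0)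
    · have e : moveFun s ω = shift.symm ω := by simp [moveFun, h1, h0]
      have h2 : s ∈ edgeLabels ((shift.symm ω).1 1) := by rw [shift_symm_apply]; simpa using h0
      rw [e]; simp [moveFun, h2]
    · have e : moveFun s ω = ω := by simp [moveFun, h1, h0]
      rw [e, e]

theorem moveFun_continuous (s : Gen) : Continuous (moveFun s) := by
  have hc : ∀ i : ℤ, IsClopen {ω : omegaTau | s ∈ edgeLabels (ω.1 i)} := fun i =>
    (isClopen_discrete {u : Letter | s ∈ edgeLabels u}).preimage
      (f := fun ω : omegaTau => ω.1 i) ((continuous_apply i).comp continuous_subtype_val)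
  classical
  unfold moveFun
  refine Continuous.if (fun ω h => ?_) shift.continuous
    (Continuous.if (fun ω h => ?_) shift.symm.continuous continuous_id)
  · rw [(hc 1).frontier_eq] at h; exact h.elim
  · rw [(hc 0).frontier_eq] at h; exact h.elim

/-- The maps `A, B, C, D` as homeomorphisms of the subshift. -/
def move (s : Gen) : omegaTau ≃ₜ omegaTau where
  toEquiv := (moveFun_invol s).toPerm
  continuous_toFun := moveFun_continuous s
  continuous_invFun := moveFun_continuous s

/-- The group `H` generated by `A, B, C, D` in the group of homeomorphisms of the subshift. -/
def H : Subgroup (omegaTau ≃ₜ omegaTau) := Subgroup.closure (range move)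

/-! ### From sequences to graphs -/

/-- The rooted labeled graph of a two-sided sequence: the vertex set is `ℤ`, the root is `1`, the
vertices `n` and `n+1` are joined by the edges encoded by `ω_n` and both carry the loops encoded
by `ω_n`. -/
def graph (ω : ℤ → Letter) : RootedGraph where
  V := ℤ
  Adj s n k := (k = n + 1 ∧ s ∈ edgeLabels (ω n)) ∨ (n = k + 1 ∧ s ∈ edgeLabels (ω k)) ∨
    (n = k ∧ (s ∈ loopLabels (ω n) ∨ s ∈ loopLabels (ω (n - 1))))
  symm s n k h := by
    rcases h with h | h | ⟨rfl, h⟩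
    · exact Or.inr (Or.inl h)
    · exact Or.inl h
    · exact Or.inr (Or.inr ⟨rfl, h⟩)
  root := 1
  connected v := by
    have hne : ∀ u, ∃ s, s ∈ edgeLabels u := by
      intro u; cases u <;> simp [edgeLabels]
    induction v using Int.inductionOn' (b := 1) with
    | zero => exact Relation.ReflTransGen.refl
    | succ k hk ih =>
      obtain ⟨s, hs⟩ := hne (ω k)
      exact ih.tail ⟨s, Or.inl ⟨rfl, hs⟩⟩
    | pred k hk ih =>
      obtain ⟨s, hs⟩ := hne (ω (k - 1))
      exact ih.tail ⟨s, Or.inr (Or.inl ⟨by ring, hs⟩)⟩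
  locallyFinite n := by
    refine (Set.finite_Icc (n - 1) (n + 1)).subset ?_
    rintro k ⟨s, h⟩
    simp only [mem_Icc]
    omega

/-- The isomorphism class of the graph of a sequence. -/
def Graph (ω : ℤ → Letter) : GraphSpace := cls (graph ω)

end Grig

end

/-!
The group of Grigorchuk and the group of the moves are compared through the 2-adic integers.

*The subshift.* The word `τ^k(a)` is an initial segment of the ruler sequence, whose `i`-th letter
depends only on the 2-adic valuation of `i` (`iterate_tau_a`). Hence, by compactness, a sequence `ω`
belongs to the subshift iff there is a 2-adic integer `m`, its *phase*, such that `ω_n` is the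
letter of valuation `v(n + m)` for all `n ≠ -m`, while at `n = -m`, if `m` is an integer, any of
`x, y, z` may occur (`mem_omegaTau_iff`). The phase is unique, depends continuously
on `ω`, and increases by `1` under the shift. A sequence is determined by its
phase unless the phase is an integer.

*The boundary.* The reflected Gray code maps the 2-adic integers onto the boundary of the tree;
its fibres are the pairs `{m, -1 - m}` (`gray_eq_iff`). Composed with the phase it gives a
surjection `code` of the subshift onto the boundary. The generators `b, c, d` change the digit
after the first `0` according to a rule of period three, which is the rule of the ruler sequence;
therefore `code` intertwines the moves with the generators (`gray_next`, `code_move`). This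
also holds at a singular place, since the vertices at `-1` and `0` on both sides of it have the same
code. So every element of the group of the moves induces an element of Grigorchuk's group. If it
induces the identity, it moves a sequence of non-integral phase along its shift orbit to a sequence
with the same code, hence not at all, because `m` and `-1 - m` do not differ by an integer; as such
sequences are dense, it is the identity. So the two groups are isomorphic.

*Graphs.* All graphs in question have exactly one edge of each label at each vertex, so that balls
and isomorphism classes are described by the pairs of words that lead from the root to the same
vertex (`SameRel`). At a non-integral phase the graph of `ω` is the Schreier graph of its code. A
limit of Schreier graphs having a vertex with loops labeled `b, c, d` is a half-line and isolated
(`notMem_X_of_end`); any other limit is, by compactness of the subshift, the graph of a sequence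
(`exists_Graph_eq_of_mem_X`). The graph determines the sequence up to the reflection that fixes the
root (`Graph_eq_iff`), which never fixes the sequence and commutes with the moves. Therefore the
factor map is exactly two-to-one and the action descends; it is continuous on the quotient because
the factor map is a quotient map from a compact space to a Hausdorff space.

*Orbits and measures.* Moves are piecewise powers of the shift and the shift is piecewise a move.
So the orbits agree, and so do the invariant measures (`map_eq_of_piecewise`). The phase maps an
invariant probability measure to one on the 2-adic integers invariant under adding `1`, that is, to
the Haar measure, for which the integers are a null set; hence the measure is the image of the
Haar measure under the map that sends a phase to its ruler sequence (`eq_subshiftMeasure`).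
-/

namespace Grig

/-! ### The ruler sequence and 2-adic valuations -/

/-- The letters of the ruler sequence: the letter at a place of 2-adic valuation `k` is `a` for
`k = 0`, and then `x, y, z, x, y, z, …` for `k = 1, 2, 3, …`. -/
def rulerLetter : ℕ → Letter
  | 0 => .a
  | k + 1 => if k % 3 = 0 then .x else if k % 3 = 1 then .y else .z

theorem rulerLetter_eq_a_iff {k : ℕ} : rulerLetter k = .a ↔ k = 0 := by
  cases k with
  | zero => simp [rulerLetter]
  | succ k => simp only [rulerLetter]; split_ifs <;> simp

theorem rulerLetter_succ_ne (k : ℕ) : rulerLetter (k + 1) ≠ rulerLetter k := by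
  cases k with
  | zero => simp [rulerLetter]
  | succ k =>
    have : k % 3 < 3 := Nat.mod_lt _ (by norm_num)
    simp only [rulerLetter]
    split_ifs <;> first | omega | simp

/-- Every letter other than `a` occurs at arbitrarily high valuations. -/
theorem exists_rulerLetter_eq {l : Letter} (hl : l ≠ .a) (n : ℕ) :
    ∃ k, n ≤ k ∧ rulerLetter k = l := by
  cases l with
  | a => exact absurd rfl hl
  | x => exact ⟨3 * n + 1, by omega, by simp [rulerLetter]⟩
  | y => exact ⟨3 * n + 2, by omega, by simp [rulerLetter, Nat.add_mod]⟩
  | z => exact ⟨3 * n + 3, by omega, by simp [rulerLetter, Nat.add_mod]⟩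

theorem two_pow_dvd_iff {z : ℤ_[2]} (hz : z ≠ 0) (k : ℕ) :
    (2 : ℤ_[2]) ^ k ∣ z ↔ k ≤ z.valuation := by
  rw [← PadicInt.mem_span_pow_iff_le_valuation z hz, Ideal.mem_span_singleton]
  rfl

theorem valuation_eq_of_dvd_sub {u v : ℤ_[2]} (hu : u ≠ 0)
    (h : (2 : ℤ_[2]) ^ (u.valuation + 1) ∣ v - u) : v ≠ 0 ∧ v.valuation = u.valuation := by
  have key : ∀ k ≤ u.valuation + 1, ((2 : ℤ_[2]) ^ k ∣ v ↔ (2 : ℤ_[2]) ^ k ∣ u) := fun k hk => by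
    have := (pow_dvd_pow (2 : ℤ_[2]) hk).trans h
    rw [← dvd_iff_dvd_of_dvd_sub this]
  have h1 : ¬ (2 : ℤ_[2]) ^ (u.valuation + 1) ∣ v := by
    rw [key _ le_rfl, two_pow_dvd_iff hu]; omega
  have hv : v ≠ 0 := fun h0 => h1 (h0 ▸ dvd_zero _)
  have h2 := (key u.valuation (by omega)).2 ((two_pow_dvd_iff hu _).2 le_rfl)
  rw [two_pow_dvd_iff hv] at h1 h2
  exact ⟨hv, by omega⟩

theorem isOpen_dvd_sub (k : ℕ) (u : ℤ_[2]) : IsOpen {v : ℤ_[2] | (2 : ℤ_[2]) ^ k ∣ v - u} := by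
  have : {v : ℤ_[2] | (2 : ℤ_[2]) ^ k ∣ v - u} = Metric.closedBall u ((2 : ℝ) ^ (-k : ℤ)) := by
    ext v
    have := PadicInt.norm_le_pow_iff_mem_span_pow (v - u) k
    rw [Ideal.mem_span_singleton] at this
    simpa [dist_eq_norm] using this.symm
  rw [this]
  exact IsUltrametricDist.isOpen_closedBall u (by positivity)

theorem valuation_two_mul {z : ℤ_[2]} (hz : z ≠ 0) : (2 * z).valuation = z.valuation + 1 := by
  have h := PadicInt.valuation_p_pow_mul (p := 2) 1 z hz
  simpa [add_comm] using h

theorem not_two_dvd_two_mul_add_one (z : ℤ_[2]) : ¬ (2 : ℤ_[2]) ∣ 2 * z + 1 := by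
  intro h
  have h1 : (2 : ℤ_[2]) ∣ 1 := (dvd_add_right (dvd_mul_right 2 z)).1 h
  exact PadicInt.prime_p.not_dvd_one (by exact_mod_cast h1)

theorem two_mul_add_one_ne_zero (z : ℤ_[2]) : 2 * z + 1 ≠ 0 := fun h =>
  not_two_dvd_two_mul_add_one z (h ▸ dvd_zero _)

theorem valuation_two_mul_add_one (z : ℤ_[2]) : (2 * z + 1).valuation = 0 := by
  have h := not_two_dvd_two_mul_add_one z
  rw [← pow_one (2 : ℤ_[2]), two_pow_dvd_iff (by simpa using two_mul_add_one_ne_zero z)] at h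
  simpa using h

theorem valuation_neg (z : ℤ_[2]) : (-z).valuation = z.valuation := by
  by_cases hz : z = 0
  · simp [hz]
  apply le_antisymm
  · rw [← two_pow_dvd_iff hz, ← dvd_neg, two_pow_dvd_iff (neg_ne_zero.2 hz)]
  · rw [← two_pow_dvd_iff (neg_ne_zero.2 hz), dvd_neg, two_pow_dvd_iff hz]

theorem even_or_odd (z : ℤ_[2]) : ∃ h : ℤ_[2], z = 2 * h ∨ z = 2 * h + 1 := by
  obtain ⟨n, hn, h⟩ := PadicInt.exists_mem_range (p := 2) z
  rw [PadicInt.maximalIdeal_eq_span_p, Ideal.mem_span_singleton] at h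
  obtain ⟨q, hq⟩ := h
  have hz : z = 2 * q + n := by
    rw [← sub_eq_iff_eq_add]; exact_mod_cast hq
  refine ⟨q, ?_⟩
  interval_cases n
  · left; simpa using hz
  · right; simpa using hz

/-- A letter `l` fits a 2-adic place `z`: it is the letter of the ruler sequence if `z ≠ 0`, and
any letter other than `a` if `z = 0`. -/
def Fits (l : Letter) (z : ℤ_[2]) : Prop :=
  (z = 0 → l ≠ .a) ∧ (z ≠ 0 → l = rulerLetter z.valuation)

theorem fits_of_ne_zero {l : Letter} {z : ℤ_[2]} (hz : z ≠ 0) :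
    Fits l z ↔ l = rulerLetter z.valuation := by simp [Fits, hz]

theorem fits_congr {u v : ℤ_[2]} (l : Letter) (hu : u ≠ 0)
    (h : (2 : ℤ_[2]) ^ (u.valuation + 1) ∣ v - u) : Fits l v ↔ Fits l u := by
  obtain ⟨hv, e⟩ := valuation_eq_of_dvd_sub hu h
  rw [fits_of_ne_zero hu, fits_of_ne_zero hv, e]

theorem isClosed_fits (l : Letter) : IsClosed {z | Fits l z} := by
  rw [← isOpen_compl_iff, isOpen_iff_mem_nhds]
  intro u hu
  by_cases h0 : u = 0
  · subst h0
    have hl : l = .a := by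
      by_contra h; exact hu ⟨fun _ => h, fun h => absurd rfl h⟩
    refine mem_of_superset ((isOpen_dvd_sub 1 0).mem_nhds (by simp)) fun v hv hf => ?_
    have hv0 : v ≠ 0 := fun h => hf.1 h hl
    have h1 := hf.2 hv0
    rw [hl, eq_comm, rulerLetter_eq_a_iff] at h1
    have h2 := (two_pow_dvd_iff hv0 1).1 (by simpa using hv)
    omega
  · refine mem_of_superset ((isOpen_dvd_sub (u.valuation + 1) u).mem_nhds (by simp))
      fun v hv hf => ?_
    exact hu ((fits_congr l h0 hv).1 hf)

theorem isOpen_ne_zero_and_fits (l : Letter) : IsOpen {z | z ≠ 0 ∧ Fits l z} := by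
  rw [isOpen_iff_mem_nhds]
  rintro u ⟨h0, hu⟩
  refine mem_of_superset ((isOpen_dvd_sub (u.valuation + 1) u).mem_nhds (by simp)) fun v hv => ?_
  exact ⟨(valuation_eq_of_dvd_sub h0 hv).1, (fits_congr l h0 hv).2 hu⟩

/-! ### Sequences of the subshift as ruler sequences with a 2-adic phase -/

/-- The sequence `ω` is the ruler sequence with phase `m`: the letter at `n` fits the 2-adic
place `n + m`. If `m` is an integer, the letter at `-m` may be any of `x, y, z`. -/
def IsPos (m : ℤ_[2]) (ω : ℤ → Letter) : Prop := ∀ n : ℤ, Fits (ω n) (n + m)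

theorem isClosed_fits_prod : IsClosed {p : Letter × ℤ_[2] | Fits p.1 p.2} := by
  have : {p : Letter × ℤ_[2] | Fits p.1 p.2} =
      ⋂ l : Letter, ({p | p.1 ∈ ({l}ᶜ : Set Letter)} ∪ {p | p.2 ∈ {z | Fits l z}}) := by
    ext ⟨l, z⟩
    simp only [mem_ofPred_eq, mem_iInter, mem_union, mem_compl_iff, mem_singleton_iff]
    exact ⟨fun h l' => by by_cases e : l = l' <;> [exact Or.inr (e ▸ h); exact Or.inl e],
      fun h => (h l).resolve_left (not_not.2 rfl)⟩
  rw [this]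
  exact isClosed_iInter fun l => ((isClosed_discrete _).preimage continuous_fst).union
    ((isClosed_fits l).preimage continuous_snd)

theorem isClosed_isPos : IsClosed {p : ℤ_[2] × (ℤ → Letter) | IsPos p.1 p.2} := by
  simp only [IsPos, ofPred_forall]
  exact isClosed_iInter fun n => isClosed_fits_prod.preimage
    (f := fun p : ℤ_[2] × (ℤ → Letter) => (p.2 n, (n : ℤ_[2]) + p.1)) (by fun_prop)

/-- Two phases of the same sequence agree: if `m - m'` had valuation `k`, then a place at which the
first phase shows the letter of valuation `k + 1` would show the letter of valuation `k` in the
second phase. -/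
theorem IsPos.unique {m m' : ℤ_[2]} {ω : ℤ → Letter} (h : IsPos m ω) (h' : IsPos m' ω) :
    m = m' := by
  by_contra hne
  have hd : m' - m ≠ 0 := sub_ne_zero.2 (Ne.symm hne)
  set k := (m' - m).valuation with hk
  obtain ⟨n, hn⟩ := PadicInt.denseRange_intCast.exists_mem_open
    (isOpen_dvd_sub (k + 2) ((2 : ℤ_[2]) ^ (k + 1) - m)) ⟨(2 : ℤ_[2]) ^ (k + 1) - m, by simp⟩
  have hp : ((2 : ℤ_[2]) ^ (k + 1)) ≠ 0 := pow_ne_zero _ two_ne_zero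
  have hpv : ((2 : ℤ_[2]) ^ (k + 1)).valuation = k + 1 := by
    have := PadicInt.valuation_p (p := 2)
    rw [PadicInt.valuation_pow]; push_cast at this; simp [this]
  have hn' : (2 : ℤ_[2]) ^ (k + 2) ∣ (n + m) - (2 : ℤ_[2]) ^ (k + 1) := by
    have e : (n + m) - (2 : ℤ_[2]) ^ (k + 1) = n - ((2 : ℤ_[2]) ^ (k + 1) - m) := by ring
    rw [e]; exact hn
  obtain ⟨h1, h2⟩ := valuation_eq_of_dvd_sub hp (by rw [hpv]; exact hn')
  obtain ⟨h3, h4⟩ := valuation_eq_of_dvd_sub (v := n + m') hd (by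
    have e : (n : ℤ_[2]) + m' - (m' - m) = n + m := by ring
    rw [e, ← hk, two_pow_dvd_iff h1, h2, hpv])
  have e1 := (h n).2 h1
  have e2 := (h' n).2 h3
  rw [h2, hpv] at e1
  rw [h4, ← hk] at e2
  exact rulerLetter_succ_ne k (e1.symm.trans e2)

theorem tau_append (u v : List Letter) : tau (u ++ v) = tau u ++ tau v := by simp [tau]

theorem iterate_tau_append (k : ℕ) (u v : List Letter) :
    tau^[k] (u ++ v) = tau^[k] u ++ tau^[k] v := by
  induction k generalizing u v with
  | zero => rfl
  | succ k ih => simp [tau_append, ih]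

theorem tau_rulerLetter_succ (k : ℕ) : tau [rulerLetter (k + 1)] = [rulerLetter (k + 2)] := by
  have : k % 3 < 3 := Nat.mod_lt _ (by norm_num)
  simp only [rulerLetter]
  have e : k % 3 = 0 ∨ k % 3 = 1 ∨ k % 3 = 2 := by omega
  rcases e with e | e | e <;> simp [e, Nat.add_mod, tau, tauLetter]

theorem iterate_tau_x (k : ℕ) : tau^[k] [.x] = [rulerLetter (k + 1)] := by
  induction k with
  | zero => simp [rulerLetter]
  | succ k ih => rw [Function.iterate_succ_apply', ih, tau_rulerLetter_succ]

theorem iterate_tau_length {s : Letter} (hs : s ≠ .a) (k : ℕ) : (tau^[k] [s]).length = 1 := by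
  induction k generalizing s with
  | zero => rfl
  | succ k ih =>
    rw [Function.iterate_succ_apply]
    cases s with
    | a => exact absurd rfl hs
    | x => exact ih (s := .y) (by simp)
    | y => exact ih (s := .z) (by simp)
    | z => exact ih (s := .x) (by simp)

/-- The word `τ^k(a)` is the initial segment of length `2^(k+1) - 1` of the ruler sequence. -/
theorem iterate_tau_a (k : ℕ) : tau^[k] [.a] =
    (List.range (2 ^ (k + 1) - 1)).map fun i => rulerLetter ((i + 1 : ℕ) : ℤ_[2]).valuation := by
  induction k with
  | zero => simp [rulerLetter]
  | succ k ih =>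
    have e : tau^[k + 1] [.a] = tau^[k] ([.a] ++ ([.x] ++ [.a])) := rfl
    rw [e, iterate_tau_append, iterate_tau_append, ih, iterate_tau_x]
    have hpos : 0 < 2 ^ (k + 1) := by positivity
    have hlen : 2 ^ (k + 1 + 1) - 1 = (2 ^ (k + 1) - 1) + (1 + (2 ^ (k + 1) - 1)) := by
      rw [pow_succ]; omega
    rw [hlen, List.range_add, List.range_add]
    simp only [List.map_append, List.map_map, List.append_cancel_left_eq]
    congr 1
    · have e2 : ((2 : ℤ_[2]) ^ (k + 1)).valuation = k + 1 := by
        have := PadicInt.valuation_p (p := 2)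
        rw [PadicInt.valuation_pow]; push_cast at this; simp [this]
      simp [e2]
    · refine List.map_congr_left fun i hi => ?_
      rw [List.mem_range] at hi
      have hne : ((i + 1 : ℕ) : ℤ_[2]) ≠ 0 := by exact_mod_cast (Nat.succ_ne_zero i)
      -- the first `2 ^ (k + 1) - 1` positive integers are not divisible by `2 ^ (k + 1)`
      have hv : ((i + 1 : ℕ) : ℤ_[2]).valuation + 1 ≤ k + 1 := by
        by_contra hlt
        have h1 : (2 : ℤ_[2]) ^ (k + 1) ∣ ((i + 1 : ℕ) : ℤ_[2]) :=
          (two_pow_dvd_iff hne _).2 (by omega)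
        have h2 := (PadicInt.pow_p_dvd_int_iff (p := 2) (k + 1) ((i + 1 : ℕ) : ℤ)).1
          (by exact_mod_cast h1)
        have h3 : 2 ^ (k + 1) ∣ i + 1 := by exact_mod_cast h2
        have := Nat.le_of_dvd (by omega) h3
        omega
      refine congrArg rulerLetter (valuation_eq_of_dvd_sub hne ?_).2.symm
      refine (pow_dvd_pow _ hv).trans ⟨1, ?_⟩
      have : 2 ^ (k + 1) - 1 + (1 + i) + 1 = 2 ^ (k + 1) + (i + 1) := by omega
      simp only [Function.comp, this]
      push_cast; ring

/-- Near a phase of `ω` there are non-singular places for every finite window of `ω`. -/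
theorem IsPos.exists_window {m : ℤ_[2]} {ω : ℤ → Letter} (h : IsPos m ω) (S : Finset ℤ) :
    ∃ m' : ℤ_[2], ∀ n ∈ S, (n : ℤ_[2]) + m' ≠ 0 ∧ Fits (ω n) (n + m') := by
  by_cases hs : ∃ n₀ ∈ S, (n₀ : ℤ_[2]) + m = 0
  · obtain ⟨n₀, -, h0⟩ := hs
    -- replace the singular place by one of a valuation `j` with the same letter, so high that
    -- the other letters of the window do not change
    obtain ⟨j, hj, hjl⟩ := exists_rulerLetter_eq ((h n₀).1 h0)
      (S.sup fun n => ((n : ℤ_[2]) + m).valuation + 1)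
    refine ⟨m + 2 ^ j, fun n hn => ?_⟩
    by_cases hn0 : n = n₀
    · have e : (n : ℤ_[2]) + (m + 2 ^ j) = 2 ^ j := by rw [hn0, ← add_assoc, h0, zero_add]
      have hp : ((2 : ℤ_[2]) ^ j).valuation = j := by
        have := PadicInt.valuation_p (p := 2)
        rw [PadicInt.valuation_pow]; push_cast at this; simp [this]
      have h2 : (2 : ℤ_[2]) ^ j ≠ 0 := pow_ne_zero _ two_ne_zero
      rw [e, fits_of_ne_zero h2, hp, hn0, hjl]
      exact ⟨h2, rfl⟩
    · have hne : (n : ℤ_[2]) + m ≠ 0 := fun h1 => hn0 (by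
        have : (n : ℤ_[2]) = n₀ := add_right_cancel (h1.trans h0.symm)
        exact_mod_cast this)
      have hle : ((n : ℤ_[2]) + m).valuation + 1 ≤ j :=
        (Finset.le_sup (f := fun n : ℤ => ((n : ℤ_[2]) + m).valuation + 1) hn).trans hj
      have hd : (2 : ℤ_[2]) ^ (((n : ℤ_[2]) + m).valuation + 1) ∣ n + (m + 2 ^ j) - (n + m) := by
        have e : (n : ℤ_[2]) + (m + 2 ^ j) - (n + m) = 2 ^ j := by ring
        rw [e]; exact pow_dvd_pow _ hle
      exact ⟨(valuation_eq_of_dvd_sub hne hd).1, (fits_congr _ hne hd).2 (h n)⟩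
  · push Not at hs
    exact ⟨m, fun n hn => ⟨hs n hn, h n⟩⟩

theorem isOpen_window (ω : ℤ → Letter) (S : Finset ℤ) :
    IsOpen {m : ℤ_[2] | ∀ n ∈ S, (n : ℤ_[2]) + m ≠ 0 ∧ Fits (ω n) (n + m)} := by
  have : {m : ℤ_[2] | ∀ n ∈ S, (n : ℤ_[2]) + m ≠ 0 ∧ Fits (ω n) (n + m)} =
      ⋂ n ∈ S, (fun m => (n : ℤ_[2]) + m) ⁻¹' {z | z ≠ 0 ∧ Fits (ω n) z} := by
    ext; simp
  rw [this]
  exact isOpen_biInter_finset fun n _ => (isOpen_ne_zero_and_fits _).preimage (by fun_prop)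

theorem map_range_infix {α : Type*} (f : ℕ → α) {j k n : ℕ} (h : j + k ≤ n) :
    ((List.range k).map fun i => f (j + i)) <:+: (List.range n).map f := by
  obtain ⟨r, rfl⟩ := Nat.exists_eq_add_of_le h
  refine ⟨(List.range j).map f, (List.range r).map fun i => f (j + k + i), ?_⟩
  simp [List.range_add, Function.comp_def]

theorem getElem?_of_infix_map_range {α : Type*} {f : ℕ → α} {w : List α} {n : ℕ}
    (h : w <:+: (List.range n).map f) : ∃ j, ∀ i < w.length, w[i]? = some (f (j + i)) := by
  obtain ⟨s, t, e⟩ := h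
  refine ⟨s.length, fun i hi => ?_⟩
  have h1 : (s ++ w ++ t)[s.length + i]? = w[i]? := by
    rw [List.append_assoc, List.getElem?_append_right (by omega),
      List.getElem?_append_left (by omega)]
    simp
  have hlt : s.length + i < n := by
    have := congrArg List.length e
    simp at this; omega
  rw [← h1, e]
  simp [hlt]

theorem subword_eq_map (ω : ℤ → Letter) (m : ℤ) (k : ℕ) :
    subword ω m k = (List.range k).map fun i : ℕ => ω (m + (i : ℤ)) := by
  simp [subword, List.map_eq_flatMap, List.flatMap_assoc]

theorem IsPos.mem_omegaTau {m : ℤ_[2]} {ω : ℤ → Letter} (h : IsPos m ω) : ω ∈ omegaTau := by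
  intro n₀ k
  obtain ⟨m', hm'⟩ := h.exists_window (Finset.Ico n₀ (n₀ + k))
  obtain ⟨c, hc⟩ : ∃ c : ℕ, 0 ≤ n₀ + c := ⟨n₀.natAbs, by omega⟩
  -- an integer `r + c + 1` near `m'`, large enough for all places of the window to be positive
  obtain ⟨r, hr⟩ := PadicInt.denseRange_natCast.exists_mem_open
    ((isOpen_window ω (Finset.Ico n₀ (n₀ + k))).preimage
      (f := fun z : ℤ_[2] => z + (c + 1 : ℕ)) (by fun_prop))
    ⟨m' - (c + 1 : ℕ), by simpa using hm'⟩
  obtain ⟨j, hj⟩ : ∃ j : ℕ, (j : ℤ) = n₀ + r + c :=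
    ⟨(n₀ + r + c).toNat, by omega⟩
  refine ⟨.a, j + k, ?_⟩
  rw [iterate_tau_a]
  have e : subword ω n₀ k =
      (List.range k).map fun i => rulerLetter ((j + i + 1 : ℕ) : ℤ_[2]).valuation := by
    rw [subword_eq_map]
    refine List.map_congr_left fun i hi => ?_
    rw [List.mem_range] at hi
    obtain ⟨h1, h2⟩ := hr (n₀ + i) (by simp [hi])
    have e1 : ((n₀ + i : ℤ) : ℤ_[2]) + (r + (c + 1 : ℕ)) = ((j + i + 1 : ℕ) : ℤ_[2]) := by
      have : n₀ + i + ((r + (c + 1) : ℕ) : ℤ) = ((j + i + 1 : ℕ) : ℤ) := by omega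
      have := congrArg (Int.cast : ℤ → ℤ_[2]) this
      push_cast at this ⊢
      exact this
    rw [fits_of_ne_zero h1, e1] at h2
    exact h2
  rw [e]
  have hle : j + k ≤ 2 ^ (j + k + 1) - 1 := by
    have := Nat.lt_two_pow_self (n := j + k)
    rw [pow_succ]; omega
  exact map_range_infix (fun i => rulerLetter ((i + 1 : ℕ) : ℤ_[2]).valuation) hle

/-- Every finite window of a sequence of the subshift occurs in the ruler sequence at some positive
integer; by compactness of the 2-adic integers these have a limit that is a phase. -/
theorem exists_isPos {ω : ℤ → Letter} (h : ω ∈ omegaTau) : ∃ m, IsPos m ω := by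
  have hne : ∀ N : ℕ, {m : ℤ_[2] | ∀ n ∈ Icc (-N : ℤ) N, Fits (ω n) (n + m)}.Nonempty := by
    intro N
    obtain ⟨s, k, hk⟩ := h (-N) (2 * N + 2)
    have hs : s = .a := by
      by_contra hs
      have h1 := hk.length_le
      rw [iterate_tau_length hs] at h1
      simp [subword_eq_map] at h1
    rw [hs, iterate_tau_a] at hk
    obtain ⟨j, hj⟩ := getElem?_of_infix_map_range hk
    refine ⟨((j + 1 + N : ℕ) : ℤ_[2]), fun n hn => ?_⟩
    obtain ⟨i, hi⟩ : ∃ i : ℕ, (i : ℤ) = n + N := ⟨(n + N).toNat, by have := hn.1; omega⟩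
    have hi2 : i < 2 * N + 2 := by have := hn.2; omega
    have h1 := hj i (by simpa [subword_eq_map] using hi2)
    have e1 : (n : ℤ_[2]) + ((j + 1 + N : ℕ) : ℤ_[2]) = ((j + i + 1 : ℕ) : ℤ_[2]) := by
      have : n + (j + 1 + N : ℕ) = ((j + i + 1 : ℕ) : ℤ) := by push_cast; omega
      exact_mod_cast congrArg (Int.cast : ℤ → ℤ_[2]) this
    have h0 : ((j + i + 1 : ℕ) : ℤ_[2]) ≠ 0 := by exact_mod_cast Nat.succ_ne_zero (j + i)
    rw [e1, fits_of_ne_zero h0]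
    have e2 : (-N : ℤ) + i = n := by omega
    simpa [subword_eq_map, hi2, e2] using h1
  have hcl : ∀ N : ℕ, IsClosed {m : ℤ_[2] | ∀ n ∈ Icc (-N : ℤ) N, Fits (ω n) (n + m)} := by
    intro N
    simp only [ofPred_forall]
    exact isClosed_biInter fun n _ => (isClosed_fits _).preimage (by fun_prop)
  obtain ⟨m, hm⟩ := IsCompact.nonempty_iInter_of_sequence_nonempty_isCompact_isClosed
    (fun N : ℕ => {m : ℤ_[2] | ∀ n ∈ Icc (-N : ℤ) N, Fits (ω n) (n + m)})
    (fun N m hm n hn => hm n ⟨by have := hn.1; push_cast; omega, by have := hn.2; push_cast; omega⟩)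
    hne (hcl 0).isCompact hcl
  refine ⟨m, fun n => ?_⟩
  rw [mem_iInter] at hm
  exact hm n.natAbs n ⟨by omega, by omega⟩

theorem mem_omegaTau_iff {ω : ℤ → Letter} : ω ∈ omegaTau ↔ ∃ m, IsPos m ω :=
  ⟨exists_isPos, fun ⟨_, h⟩ => h.mem_omegaTau⟩

theorem isClosed_omegaTau : IsClosed omegaTau := by
  have : omegaTau = Prod.snd '' {p : ℤ_[2] × (ℤ → Letter) | IsPos p.1 p.2} := by
    ext ω; simp [mem_omegaTau_iff]
  rw [this]
  exact isClosedMap_snd_of_compactSpace _ isClosed_isPos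

instance : CompactSpace omegaTau := isCompact_iff_compactSpace.1 isClosed_omegaTau.isCompact

/-- The 2-adic phase of a sequence of the subshift. -/
noncomputable def phase (ω : omegaTau) : ℤ_[2] := (exists_isPos ω.2).choose

theorem isPos_phase (ω : omegaTau) : IsPos (phase ω) ω.1 := (exists_isPos ω.2).choose_spec

theorem phase_eq {ω : omegaTau} {m : ℤ_[2]} (h : IsPos m ω.1) : phase ω = m :=
  (isPos_phase ω).unique h

theorem continuous_phase : Continuous phase := by
  -- the graph of the map is closed and its values lie in a compact space
  rw [continuous_iff_isClosed]
  intro C hC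
  have : phase ⁻¹' C = Prod.snd ''
      ({p : ℤ_[2] × omegaTau | IsPos p.1 p.2.1} ∩ {p | p.1 ∈ C}) := by
    ext ω
    simp only [mem_preimage, mem_image, mem_inter_iff, mem_ofPred_eq, Prod.exists, exists_eq_right]
    exact ⟨fun h => ⟨_, isPos_phase ω, h⟩, fun ⟨m, h, hm⟩ => phase_eq h ▸ hm⟩
  rw [this]
  exact isClosedMap_snd_of_compactSpace _
    ((isClosed_isPos.preimage (f := fun p : ℤ_[2] × omegaTau => (p.1, p.2.1)) (by fun_prop)).inter
      (hC.preimage continuous_fst))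

theorem phase_shift (ω : omegaTau) : phase (shift ω) = phase ω + 1 := by
  refine phase_eq fun n => ?_
  have h := isPos_phase ω (n + 1)
  have e : (n : ℤ_[2]) + (phase ω + 1) = ((n + 1 : ℤ) : ℤ_[2]) + phase ω := by push_cast; ring
  rw [e]; exact h

open Classical in
/-- The ruler sequence with phase `m`, with the letter `x` at the singular place if there is
one. -/
noncomputable def rulerSeq (m : ℤ_[2]) : ℤ → Letter := fun n =>
  if (n : ℤ_[2]) + m = 0 then .x else rulerLetter ((n : ℤ_[2]) + m).valuation

theorem isPos_rulerSeq (m : ℤ_[2]) : IsPos m (rulerSeq m) := fun n =>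
  ⟨fun h => by simp [rulerSeq, h], fun h => by simp [rulerSeq, h]⟩

/-- The ruler sequence with phase `m` as a point of the subshift. -/
noncomputable def rulerPoint (m : ℤ_[2]) : omegaTau := ⟨rulerSeq m, (isPos_rulerSeq m).mem_omegaTau⟩

@[simp] theorem phase_rulerPoint (m : ℤ_[2]) : phase (rulerPoint m) = m :=
  phase_eq (isPos_rulerSeq m)

/-- A non-integral phase determines the sequence. -/
theorem IsPos.eq_of_not_int {m : ℤ_[2]} (hm : m ∉ range (Int.cast : ℤ → ℤ_[2])) {ω ω' : ℤ → Letter}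
    (h : IsPos m ω) (h' : IsPos m ω') : ω = ω' := by
  funext n
  have h0 : (n : ℤ_[2]) + m ≠ 0 := fun h0 => hm ⟨-n, by
    push_cast; exact neg_eq_of_add_eq_zero_right h0⟩
  rw [(h n).2 h0, (h' n).2 h0]

/-- Neighbourhoods in the subshift contain all sequences that agree on a finite window. -/
theorem exists_window_subset {ω : omegaTau} {U : Set omegaTau} (hU : U ∈ 𝓝 ω) :
    ∃ S : Finset ℤ, ∀ ω' : omegaTau, (∀ n ∈ S, ω'.1 n = ω.1 n) → ω' ∈ U := by
  rw [nhds_subtype, mem_comap] at hU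
  obtain ⟨V, hV, hVU⟩ := hU
  rw [nhds_pi, Filter.mem_pi] at hV
  obtain ⟨I, hI, t, ht, hsub⟩ := hV
  refine ⟨hI.toFinset, fun ω' h => hVU (hsub fun n hn => ?_)⟩
  rw [h n (hI.mem_toFinset.2 hn)]
  exact mem_of_mem_nhds (ht n)

theorem window_mem_nhds (ω : omegaTau) (S : Finset ℤ) :
    {ω' : omegaTau | ∀ n ∈ S, ω'.1 n = ω.1 n} ∈ 𝓝 ω := by
  have : {ω' : omegaTau | ∀ n ∈ S, ω'.1 n = ω.1 n} =
      ⋂ n ∈ S, (fun ω' : omegaTau => ω'.1 n) ⁻¹' {ω.1 n} := by ext; simp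
  rw [this]
  refine (isOpen_biInter_finset fun n _ => (isOpen_discrete _).preimage ?_).mem_nhds (by simp)
  exact (continuous_apply n).comp continuous_subtype_val

/-! ### The Gray code from the 2-adic integers to the boundary of the tree -/

/-- A 2-adic integer as its lowest binary digit and the number formed by the other digits. -/
noncomputable def digitEquiv : Bool × ℤ_[2] ≃ ℤ_[2] :=
  Equiv.ofBijective (fun p => 2 * p.2 + cond p.1 1 0) (by
    constructor
    · rintro ⟨i, u⟩ ⟨j, v⟩ h
      cases i <;> cases j <;> simp only [cond_true, cond_false, add_zero] at h
      · simpa using h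
      · exact absurd ⟨u, h.symm⟩ (not_two_dvd_two_mul_add_one v)
      · exact absurd ⟨v, h⟩ (not_two_dvd_two_mul_add_one u)
      · simpa using h
    · intro z
      obtain ⟨h, rfl | rfl⟩ := even_or_odd z
      exacts [⟨(false, h), by simp⟩, ⟨(true, h), by simp⟩])

/-- The lowest binary digit. -/
noncomputable def parity (z : ℤ_[2]) : Bool := (digitEquiv.symm z).1

/-- The number formed by all binary digits but the lowest. -/
noncomputable def half (z : ℤ_[2]) : ℤ_[2] := (digitEquiv.symm z).2

theorem continuous_digitEquiv : Continuous digitEquiv := by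
  change Continuous fun p : Bool × ℤ_[2] => 2 * p.2 + cond p.1 1 0
  have : Continuous fun b : Bool => cond b (1 : ℤ_[2]) 0 := continuous_of_discreteTopology
  fun_prop

theorem continuous_digitEquiv_symm : Continuous digitEquiv.symm :=
  (Continuous.homeoOfEquivCompactToT2 continuous_digitEquiv).symm.continuous

theorem continuous_parity : Continuous parity := continuous_fst.comp continuous_digitEquiv_symm

theorem continuous_half : Continuous half := continuous_snd.comp continuous_digitEquiv_symm

theorem digitEquiv_symm_two_mul (h : ℤ_[2]) : digitEquiv.symm (2 * h) = (false, h) := by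
  rw [Equiv.symm_apply_eq]; exact (add_zero _).symm

theorem digitEquiv_symm_two_mul_add_one (h : ℤ_[2]) :
    digitEquiv.symm (2 * h + 1) = (true, h) := by
  rw [Equiv.symm_apply_eq]; rfl

@[simp] theorem parity_two_mul (h : ℤ_[2]) : parity (2 * h) = false := by
  simp [parity, digitEquiv_symm_two_mul]

@[simp] theorem parity_two_mul_add_one (h : ℤ_[2]) : parity (2 * h + 1) = true := by
  simp [parity, digitEquiv_symm_two_mul_add_one]

@[simp] theorem half_two_mul (h : ℤ_[2]) : half (2 * h) = h := by
  simp [half, digitEquiv_symm_two_mul]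

@[simp] theorem half_two_mul_add_one (h : ℤ_[2]) : half (2 * h + 1) = h := by
  simp [half, digitEquiv_symm_two_mul_add_one]

theorem parity_sub_one (z : ℤ_[2]) : parity (z - 1) = !parity z := by
  obtain ⟨h, rfl | rfl⟩ := even_or_odd z
  · have e : 2 * h - 1 = 2 * (h - 1) + 1 := by ring
    simp [e]
  · simp

theorem parity_neg_one_sub (z : ℤ_[2]) : parity (-1 - z) = !parity z := by
  obtain ⟨h, rfl | rfl⟩ := even_or_odd z
  · have e : -1 - 2 * h = 2 * (-1 - h) + 1 := by ring
    simp [e]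
  · have e : -1 - (2 * h + 1) = 2 * (-1 - h) := by ring
    simp [e]

theorem half_neg_one_sub (z : ℤ_[2]) : half (-1 - z) = -1 - half z := by
  obtain ⟨h, rfl | rfl⟩ := even_or_odd z
  · have e : -1 - 2 * h = 2 * (-1 - h) + 1 := by ring
    simp [e]
  · have e : -1 - (2 * h + 1) = 2 * (-1 - h) := by ring
    simp [e]

/-- The reflected Gray code: the `n`-th digit of the boundary point records whether the binary
digits number `n` and `n + 1` of the 2-adic integer agree. -/
noncomputable def gray : ℤ_[2] → Boundary
  | m, 0 => parity m == parity (half m)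
  | m, n + 1 => gray (half m) n

theorem gray_zero (m : ℤ_[2]) : gray m 0 = (parity m == parity (half m)) := rfl

theorem gray_succ (m : ℤ_[2]) (n : ℕ) : gray m (n + 1) = gray (half m) n := rfl

theorem continuous_gray_apply (n : ℕ) : Continuous fun m => gray m n := by
  induction n with
  | zero =>
    have : Continuous fun p : Bool × Bool => p.1 == p.2 := continuous_of_discreteTopology
    exact this.comp (continuous_parity.prodMk (continuous_parity.comp continuous_half))
  | succ n ih => exact ih.comp continuous_half

/-- The reflection `m ↦ -1 - m` complements all binary digits, hence preserves the Gray code. -/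
theorem gray_neg_one_sub (m : ℤ_[2]) : gray (-1 - m) = gray m := by
  funext n
  induction n generalizing m with
  | zero => simp [gray_zero, half_neg_one_sub, parity_neg_one_sub]
  | succ n ih => rw [gray_succ, gray_succ, half_neg_one_sub, ih]

theorem two_pow_dvd_sub_of_gray_eq (n : ℕ) {m m' : ℤ_[2]} (h : gray m = gray m')
    (hp : parity m = parity m') : (2 : ℤ_[2]) ^ n ∣ m - m' := by
  induction n generalizing m m' with
  | zero => simp
  | succ n ih =>
    have h0 : gray m 0 = gray m' 0 := by rw [h]
    have hph : parity (half m) = parity (half m') := by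
      rw [gray_zero, gray_zero, hp] at h0
      revert h0
      cases parity m' <;> cases parity (half m) <;> cases parity (half m') <;> simp
    obtain ⟨q, hq⟩ := ih (m := half m) (m' := half m')
      (funext fun n => by rw [← gray_succ, ← gray_succ, h]) hph
    obtain ⟨u, rfl | rfl⟩ := even_or_odd m <;> obtain ⟨v, rfl | rfl⟩ := even_or_odd m' <;>
      simp at hp hq
    all_goals exact ⟨q, by linear_combination 2 * hq⟩

theorem gray_eq_iff {m m' : ℤ_[2]} : gray m = gray m' ↔ m = m' ∨ m = -1 - m' := by
  have key : ∀ {m m' : ℤ_[2]}, gray m = gray m' → parity m = parity m' → m = m' := by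
    intro m m' h hp
    by_contra hne
    have hd : m - m' ≠ 0 := sub_ne_zero.2 hne
    have := (two_pow_dvd_iff hd _).1 (two_pow_dvd_sub_of_gray_eq ((m - m').valuation + 1) h hp)
    omega
  constructor
  · intro h
    by_cases hp : parity m = parity m'
    · exact Or.inl (key h hp)
    · refine Or.inr (key (by rw [gray_neg_one_sub, h]) ?_)
      rw [parity_neg_one_sub]
      revert hp
      cases parity m <;> cases parity m' <;> simp
  · rintro (rfl | rfl)
    exacts [rfl, gray_neg_one_sub _]

theorem exists_gray_eq_below (n : ℕ) (ξ : Boundary) : ∃ m, ∀ i < n, gray m i = ξ i := by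
  induction n generalizing ξ with
  | zero => exact ⟨0, by simp⟩
  | succ n ih =>
    obtain ⟨m, hm⟩ := ih fun i => ξ (i + 1)
    -- the lowest digit is chosen so that the first digit of the code is right
    refine ⟨digitEquiv (ξ 0 == parity m, m), fun i hi => ?_⟩
    cases i with
    | zero =>
      simp only [gray_zero, half, parity, Equiv.symm_apply_apply]
      cases ξ 0 <;> cases (digitEquiv.symm m).1 <;> rfl
    | succ i =>
      rw [gray_succ, half, Equiv.symm_apply_apply]
      exact hm i (by omega)

theorem gray_surjective : Function.Surjective gray := by
  intro ξ
  have hcl : ∀ n : ℕ, IsClosed {m | ∀ i < n, gray m i = ξ i} := by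
    intro n
    simp only [ofPred_forall]
    exact isClosed_biInter fun i _ => (isClosed_discrete {ξ i}).preimage (continuous_gray_apply i)
  obtain ⟨m, hm⟩ := IsCompact.nonempty_iInter_of_sequence_nonempty_isCompact_isClosed
    (fun n : ℕ => {m | ∀ i < n, gray m i = ξ i}) (fun n m hm i hi => hm i (by omega))
    (fun n => exists_gray_eq_below n ξ) (hcl 0).isCompact hcl
  rw [mem_iInter] at hm
  exact ⟨m, funext fun n => hm (n + 1) n (by omega)⟩

/-! ### Equivariance of the Gray code -/

theorem initial_succ (ξ : Boundary) (n : ℕ) :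
    initial ξ (n + 1) = ξ 0 :: initial (fun i => ξ (i + 1)) n := by
  simp [initial, List.range_succ_eq_map, Function.comp_def]

theorem smul_apply (s : Gen) (ξ : Boundary) (n : ℕ) :
    (gGen s • ξ) n = (genFun s (ξ 0 :: initial (fun i => ξ (i + 1)) n)).getD n false := by
  rw [← initial_succ]; rfl

theorem smul_a_zero (ξ : Boundary) : (gGen .a • ξ) 0 = !ξ 0 := by
  rw [smul_apply]; cases ξ 0 <;> simp [genFun]

theorem smul_a_succ (ξ : Boundary) (n : ℕ) : (gGen .a • ξ) (n + 1) = ξ (n + 1) := by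
  rw [smul_apply]; cases ξ 0 <;> simp [genFun, initial]

theorem smul_zero_of_ne {s : Gen} (hs : s ≠ .a) (ξ : Boundary) : (gGen s • ξ) 0 = ξ 0 := by
  rw [smul_apply]; cases s <;> cases ξ 0 <;> simp_all [genFun]

theorem smul_b_succ (ξ : Boundary) (n : ℕ) : (gGen .b • ξ) (n + 1) =
    if ξ 0 then (gGen .c • fun i => ξ (i + 1) : Boundary) n
    else (gGen .a • fun i => ξ (i + 1) : Boundary) n := by
  rw [smul_apply, smul_apply, smul_apply, ← initial_succ (fun i => ξ (i + 1))]
  cases ξ 0 <;> simp [genFun]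

theorem smul_c_succ (ξ : Boundary) (n : ℕ) : (gGen .c • ξ) (n + 1) =
    if ξ 0 then (gGen .d • fun i => ξ (i + 1) : Boundary) n
    else (gGen .a • fun i => ξ (i + 1) : Boundary) n := by
  rw [smul_apply, smul_apply, smul_apply, ← initial_succ (fun i => ξ (i + 1))]
  cases ξ 0 <;> simp [genFun]

theorem smul_d_succ (ξ : Boundary) (n : ℕ) : (gGen .d • ξ) (n + 1) =
    if ξ 0 then (gGen .b • fun i => ξ (i + 1) : Boundary) n else ξ (n + 1) := by
  rw [smul_apply, smul_apply, ← initial_succ (fun i => ξ (i + 1))]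
  cases ξ 0 <;> simp [genFun, initial]

theorem mem_edgeLabels_rulerLetter_step (k : ℕ) :
    (Gen.b ∈ edgeLabels (rulerLetter (k + 2)) ↔ Gen.c ∈ edgeLabels (rulerLetter (k + 1))) ∧
    (Gen.c ∈ edgeLabels (rulerLetter (k + 2)) ↔ Gen.d ∈ edgeLabels (rulerLetter (k + 1))) ∧
    (Gen.d ∈ edgeLabels (rulerLetter (k + 2)) ↔ Gen.b ∈ edgeLabels (rulerLetter (k + 1))) := by
  have e : k % 3 = 0 ∨ k % 3 = 1 ∨ k % 3 = 2 := by omega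
  rcases e with e | e | e <;> simp [rulerLetter, e, Nat.add_mod, edgeLabels]

theorem a_notMem_edgeLabels {l : Letter} : Gen.a ∉ edgeLabels l ↔ l ≠ .a := by
  cases l <;> simp [edgeLabels]

theorem ne_a_of_mem_rulerLetter_succ {s : Gen} {k : ℕ}
    (h : s ∈ edgeLabels (rulerLetter (k + 1))) : s ≠ .a := by
  rintro rfl
  exact a_notMem_edgeLabels.2 (by simp [rulerLetter_eq_a_iff]) h

theorem gray_two_mul_zero (h : ℤ_[2]) : gray (2 * h) 0 = !parity h := by
  rw [gray_zero]; simp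

theorem gray_two_mul_add_one_zero (h : ℤ_[2]) : gray (2 * h + 1) 0 = parity h := by
  rw [gray_zero]; simp

theorem gray_two_mul_tail (h : ℤ_[2]) : (fun i => gray (2 * h) (i + 1)) = gray h := by
  funext i; rw [gray_succ, half_two_mul]

/-- The generators that label the edge of valuation `v(m)` interchange the codes of `m - 1` and
`m`. -/
theorem gray_sub_one {s : Gen} {m : ℤ_[2]} (hm : m ≠ 0)
    (hs : s ∈ edgeLabels (rulerLetter m.valuation)) : gray (m - 1) = gGen s • gray m := by
  funext n
  induction n generalizing s m with
  | zero =>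
    obtain ⟨h, rfl | rfl⟩ := even_or_odd m
    · rw [valuation_two_mul (right_ne_zero_of_mul hm)] at hs
      have e : 2 * h - 1 = 2 * (h - 1) + 1 := by ring
      rw [smul_zero_of_ne (ne_a_of_mem_rulerLetter_succ hs), e, gray_two_mul_add_one_zero,
        gray_two_mul_zero, parity_sub_one]
    · have hsa : s = .a := by simpa [valuation_two_mul_add_one, rulerLetter, edgeLabels] using hs
      rw [hsa, smul_a_zero, add_sub_cancel_right, gray_two_mul_add_one_zero, gray_two_mul_zero]
  | succ n ih =>
    obtain ⟨h, rfl | rfl⟩ := even_or_odd m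
    · have hh := right_ne_zero_of_mul hm
      rw [valuation_two_mul hh] at hs
      have hsa := ne_a_of_mem_rulerLetter_succ hs
      have e : 2 * h - 1 = 2 * (h - 1) + 1 := by ring
      rw [e, gray_succ, half_two_mul_add_one]
      obtain ⟨q, rfl | rfl⟩ := even_or_odd h
      · have hq := right_ne_zero_of_mul hh
        rw [valuation_two_mul hq] at hs
        obtain ⟨hb, hc, hd⟩ := mem_edgeLabels_rulerLetter_step q.valuation
        have hv := valuation_two_mul hq
        cases s with
        | a => exact absurd rfl hsa
        | b =>
          rw [smul_b_succ, gray_two_mul_zero, gray_two_mul_tail]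
          simpa using ih (s := .c) hh (by rw [hv]; exact hb.1 hs)
        | c =>
          rw [smul_c_succ, gray_two_mul_zero, gray_two_mul_tail]
          simpa using ih (s := .d) hh (by rw [hv]; exact hc.1 hs)
        | d =>
          rw [smul_d_succ, gray_two_mul_zero, gray_two_mul_tail]
          simpa using ih (s := .b) hh (by rw [hv]; exact hd.1 hs)
      · have ha := ih (s := .a) hh (by simp [valuation_two_mul_add_one, rulerLetter, edgeLabels])
        rw [valuation_two_mul_add_one] at hs
        cases s with
        | a => exact absurd rfl hsa
        | b =>
          rw [smul_b_succ, gray_two_mul_zero, gray_two_mul_tail]; simpa using ha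
        | c =>
          rw [smul_c_succ, gray_two_mul_zero, gray_two_mul_tail]; simpa using ha
        | d => simp [rulerLetter, edgeLabels] at hs
    · have hsa : s = .a := by simpa [valuation_two_mul_add_one, rulerLetter, edgeLabels] using hs
      rw [hsa, smul_a_succ, add_sub_cancel_right, gray_succ, gray_succ, half_two_mul,
        half_two_mul_add_one]

/-- A generator that labels neither of the edges of valuations `v(m)` and `v(m + 1)` fixes the code
of `m`. At a singular place `0` there is no edge. -/
theorem smul_gray_eq_self {s : Gen} {m : ℤ_[2]}
    (h0 : m ≠ 0 → s ∉ edgeLabels (rulerLetter m.valuation))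
    (h1 : m + 1 ≠ 0 → s ∉ edgeLabels (rulerLetter (m + 1).valuation)) :
    gGen s • gray m = gray m := by
  funext n
  have odd_a : ∀ {s : Gen} (h : ℤ_[2]),
      s ∉ edgeLabels (rulerLetter (2 * h + 1).valuation) ↔ s ≠ .a := by
    intro s h; simp [valuation_two_mul_add_one, rulerLetter, edgeLabels]
  induction n generalizing s m with
  | zero =>
    have hsa : s ≠ .a := by
      obtain ⟨h, rfl | rfl⟩ := even_or_odd m
      · exact (odd_a h).1 (h1 (two_mul_add_one_ne_zero h))
      · exact (odd_a h).1 (h0 (two_mul_add_one_ne_zero h))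
    rw [smul_zero_of_ne hsa]
  | succ n ih =>
    -- it suffices to treat even numbers, by the reflection `m ↦ -1 - m`
    suffices heven : ∀ h : ℤ_[2], (2 * h ≠ 0 → s ∉ edgeLabels (rulerLetter (2 * h).valuation)) →
        s ≠ .a → (gGen s • gray (2 * h)) (n + 1) = gray (2 * h) (n + 1) by
      obtain ⟨h, rfl | rfl⟩ := even_or_odd m
      · exact heven h h0 ((odd_a h).1 (h1 (two_mul_add_one_ne_zero h)))
      · have e : -1 - (2 * h + 1) = 2 * (-1 - h) := by ring
        have e1 : 2 * (-1 - h) = -(2 * h + 1 + 1) := by ring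
        rw [← gray_neg_one_sub (2 * h + 1), e]
        refine heven _ (fun hne => ?_) ((odd_a h).1 (h0 (two_mul_add_one_ne_zero h)))
        rw [e1, valuation_neg]
        exact h1 fun h2 => hne (by rw [e1, h2, neg_zero])
    clear h0 h1
    intro h h0 hsa
    obtain ⟨q, rfl | rfl⟩ := even_or_odd h
    · obtain ⟨hb, hc, hd⟩ := mem_edgeLabels_rulerLetter_step q.valuation
      have hv : ∀ hq : q ≠ 0, (2 * (2 * q)).valuation = q.valuation + 2 := fun hq => by
        rw [valuation_two_mul (mul_ne_zero two_ne_zero hq), valuation_two_mul hq]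
      have h0' : q ≠ 0 → s ∉ edgeLabels (rulerLetter (q.valuation + 2)) := fun hq => by
        rw [← hv hq]; exact h0 (by simpa using hq)
      have hq2 : 2 * q ≠ 0 → q ≠ 0 := right_ne_zero_of_mul
      have hval := fun h : 2 * q ≠ 0 => valuation_two_mul (hq2 h)
      cases s with
      | a => exact absurd rfl hsa
      | b =>
        rw [smul_b_succ, gray_two_mul_zero, gray_two_mul_tail, gray_succ, half_two_mul]
        simpa using ih (s := .c) (m := 2 * q)
          (fun h => by rw [hval h, ← hb]; exact h0' (hq2 h)) fun _ => (odd_a q).2 (by simp)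
      | c =>
        rw [smul_c_succ, gray_two_mul_zero, gray_two_mul_tail, gray_succ, half_two_mul]
        simpa using ih (s := .d) (m := 2 * q)
          (fun h => by rw [hval h, ← hc]; exact h0' (hq2 h)) fun _ => (odd_a q).2 (by simp)
      | d =>
        rw [smul_d_succ, gray_two_mul_zero, gray_two_mul_tail, gray_succ, half_two_mul]
        simpa using ih (s := .b) (m := 2 * q)
          (fun h => by rw [hval h, ← hd]; exact h0' (hq2 h)) fun _ => (odd_a q).2 (by simp)
    · have h3 := h0 (mul_ne_zero two_ne_zero (two_mul_add_one_ne_zero q))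
      rw [valuation_two_mul (two_mul_add_one_ne_zero q), valuation_two_mul_add_one] at h3
      cases s with
      | a => exact absurd rfl hsa
      | b => simp [rulerLetter, edgeLabels] at h3
      | c => simp [rulerLetter, edgeLabels] at h3
      | d => rw [smul_d_succ, gray_two_mul_zero]; simp

/-- The vertex of the graph of `ω` to which the edge with label `s` leads from the vertex `n`. -/
noncomputable def next (ω : ℤ → Letter) (s : Gen) (n : ℤ) : ℤ :=
  open Classical in
  if s ∈ edgeLabels (ω n) then n + 1 else if s ∈ edgeLabels (ω (n - 1)) then n - 1 else n

/-- If `ω` has phase `m`, then sending the vertex `n` of the graph of `ω` to the code of `m + n - 1`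
intertwines the moves along edges with the action on the boundary. This includes moves across a
singular place: they interchange the places `-1` and `0`, which have the same code. -/
theorem gray_next {m : ℤ_[2]} {ω : ℤ → Letter} (h : IsPos m ω) (s : Gen) (n : ℤ) :
    gray (m + (next ω s n : ℤ) - 1) = gGen s • gray (m + n - 1) := by
  set p : ℤ_[2] := m + n - 1 with hp
  have hu : Fits (ω n) (p + 1) := by
    have e : p + 1 = n + m := by rw [hp]; ring
    rw [e]; exact h n
  have hd : Fits (ω (n - 1)) p := by
    have e : p = ((n - 1 : ℤ) : ℤ_[2]) + m := by rw [hp]; push_cast; ring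
    rw [e]; exact h (n - 1)
  have hne_a : ∀ {l : Letter}, l ≠ .a → s ∈ edgeLabels l → s ≠ .a := by
    rintro l hl hs rfl; exact a_notMem_edgeLabels.2 hl hs
  unfold next
  split_ifs with h1 h2
  · have e : m + ((n + 1 : ℤ) : ℤ_[2]) - 1 = p + 1 := by rw [hp]; push_cast; ring
    rw [e]
    by_cases h0 : p + 1 = 0
    · have hs := hne_a (hu.1 h0) h1
      have hp1 : p = -1 := eq_neg_of_add_eq_zero_left h0
      have e1 : gray (p + 1) = gray p := by rw [hp1, ← gray_neg_one_sub]; norm_num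
      rw [e1, smul_gray_eq_self (fun _ => ?_) (fun h => absurd h0 h)]
      rw [hp1, valuation_neg]
      simpa [rulerLetter, edgeLabels] using hs
    · have := gray_sub_one h0 (hu.2 h0 ▸ h1)
      rw [add_sub_cancel_right] at this
      rw [this, gGen_smul_smul]
  · have e : m + ((n - 1 : ℤ) : ℤ_[2]) - 1 = p - 1 := by rw [hp]; push_cast; ring
    rw [e]
    by_cases h0 : p = 0
    · have hs := hne_a (hd.1 h0) h2
      have e1 : gray (p - 1) = gray p := by rw [h0, ← gray_neg_one_sub]; norm_num
      rw [e1, smul_gray_eq_self (fun h => absurd h0 h) (fun _ => ?_)]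
      rw [h0, zero_add]
      simpa [rulerLetter, edgeLabels] using hs
    · exact gray_sub_one h0 (hd.2 h0 ▸ h2)
  · exact (smul_gray_eq_self (fun h0 => hd.2 h0 ▸ h2) fun h0 => hu.2 h0 ▸ h1).symm

/-! ### Haar measure on the 2-adic integers and generic points of the subshift -/

noncomputable instance : MeasurableSpace ℤ_[2] := borel _

instance : BorelSpace ℤ_[2] := ⟨rfl⟩

/-- The Haar probability measure on the 2-adic integers. -/
noncomputable def haarInt : Measure ℤ_[2] := Measure.addHaarMeasure ⊤

instance : haarInt.IsAddHaarMeasure := Measure.isAddHaarMeasure_addHaarMeasure _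

instance : IsProbabilityMeasure haarInt := ⟨Measure.addHaarMeasure_self (K₀ := ⊤)⟩

instance : (𝓝[≠] (0 : ℤ_[2])).NeBot := by
  have hlt : ‖(2 : ℤ_[2])‖ < 1 := by
    have := PadicInt.norm_p (p := 2)
    push_cast at this
    rw [this]; norm_num
  refine (tendsto_nhdsWithin_iff.2 ⟨tendsto_pow_atTop_nhds_zero_of_norm_lt_one hlt,
    Eventually.of_forall fun n => ?_⟩ : Tendsto (fun n : ℕ => (2 : ℤ_[2]) ^ n) atTop _).neBot
  exact pow_ne_zero _ two_ne_zero

theorem haarInt_of_countable {C : Set ℤ_[2]} (hC : C.Countable) : haarInt C = 0 := by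
  have : NullSingletonClass haarInt := Measure.IsAddHaarMeasure.nullSingletonClass haarInt
  exact hC.measure_zero haarInt

theorem countable_range_intCast : (range (Int.cast : ℤ → ℤ_[2])).Countable := countable_range _

/-- Every nonempty open set of the subshift contains ruler sequences whose phase avoids a given
countable set, because a window of a sequence occurs for an open set of phases. -/
theorem exists_rulerPoint_mem {V : Set omegaTau} (hV : IsOpen V) (hne : V.Nonempty)
    {C : Set ℤ_[2]} (hC : C.Countable) : ∃ m ∉ C, rulerPoint m ∈ V := by
  obtain ⟨ω, hω⟩ := hne
  obtain ⟨S, hS⟩ := exists_window_subset (hV.mem_nhds hω)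
  have hpos : 0 < haarInt {m : ℤ_[2] | ∀ n ∈ S, (n : ℤ_[2]) + m ≠ 0 ∧ Fits (ω.1 n) (n + m)} :=
    (isOpen_window ω.1 S).measure_pos _ ((isPos_phase ω).exists_window S)
  obtain ⟨m, hm, hmC⟩ : ∃ m ∈ {m : ℤ_[2] | ∀ n ∈ S, (n : ℤ_[2]) + m ≠ 0 ∧ Fits (ω.1 n) (n + m)},
      m ∉ C := by
    by_contra! hcon
    exact hpos.ne' (measure_mono_null hcon (haarInt_of_countable hC))
  refine ⟨m, hmC, hS _ fun n hn => ?_⟩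
  obtain ⟨h0, h1⟩ := hm n hn
  rw [h1.2 h0]
  exact (isPos_rulerSeq m n).2 h0

/-- The points of the subshift whose phase is not an integer. -/
def generic : Set omegaTau := {ω | phase ω ∉ range (Int.cast : ℤ → ℤ_[2])}

theorem dense_generic : Dense generic := by
  rw [dense_iff_inter_open]
  intro V hV hne
  obtain ⟨m, hm, hmV⟩ := exists_rulerPoint_mem hV hne countable_range_intCast
  exact ⟨_, hmV, by simpa [generic] using hm⟩

/-! ### The shift, the moves, and the group they generate -/

theorem shift_zpow_apply (k : ℤ) (ω : omegaTau) (n : ℤ) :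
    ((shift ^ k) ω).1 n = ω.1 (n + k) := by
  induction k generalizing n ω with
  | zero => simp
  | succ k ih =>
    rw [zpow_add_one, add_comm (k : ℤ) 1, ← add_assoc]
    have := ih (ω := shift ω) n
    rw [shift_apply] at this
    rw [add_right_comm]; exact this
  | pred k ih =>
    rw [zpow_sub_one]
    have := ih (ω := shift.symm ω) n
    rw [shift_symm_apply] at this
    rw [← add_sub_assoc]; exact this

theorem phase_shift_zpow (k : ℤ) (ω : omegaTau) : phase ((shift ^ k) ω) = phase ω + k := by
  refine phase_eq fun n => ?_
  have h := isPos_phase ω (n + k)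
  have e : (n : ℤ_[2]) + (phase ω + k) = ((n + k : ℤ) : ℤ_[2]) + phase ω := by push_cast; ring
  rw [e, shift_zpow_apply]; exact h

theorem move_eq_shift_zpow (s : Gen) (ω : omegaTau) :
    move s ω = (shift ^ (next ω.1 s 1 - 1)) ω := by
  change moveFun s ω = _
  unfold moveFun next
  rw [sub_self]
  split_ifs with h1 h0
  · rw [add_sub_cancel_right, zpow_one]
  · rw [zero_sub, zpow_neg_one]; rfl
  · rw [sub_self, zpow_zero]; rfl

theorem exists_shift_zpow_eq {h : omegaTau ≃ₜ omegaTau} (hh : h ∈ H) (ω : omegaTau) :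
    ∃ k : ℤ, h ω = (shift ^ k) ω := by
  induction hh using Subgroup.closure_induction generalizing ω with
  | mem x hx =>
    obtain ⟨s, rfl⟩ := hx
    exact ⟨_, move_eq_shift_zpow s ω⟩
  | one => exact ⟨0, by simp⟩
  | mul x y _ _ hx hy =>
    obtain ⟨k, hk⟩ := hy ω
    obtain ⟨l, hl⟩ := hx (y ω)
    exact ⟨l + k, by rw [zpow_add]; change x (y ω) = (shift ^ l) ((shift ^ k) ω); rw [hl, hk]⟩
  | inv x _ hx =>
    obtain ⟨k, hk⟩ := hx (x⁻¹ ω)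
    refine ⟨-k, ?_⟩
    have h1 : x (x⁻¹ ω) = ω := x.apply_symm_apply ω
    rw [h1] at hk
    rw [zpow_neg]
    exact ((shift ^ k).symm_apply_eq.2 hk).symm

/-- A generator that labels the edges encoded by a letter. -/
def edgeGen : Letter → Gen
  | .a => .a
  | .x => .b
  | .y => .b
  | .z => .c

theorem edgeGen_mem (l : Letter) : edgeGen l ∈ edgeLabels l := by
  cases l <;> simp [edgeGen, edgeLabels]

theorem shift_eq_move (ω : omegaTau) : shift ω = move (edgeGen (ω.1 1)) ω := by
  change _ = moveFun _ ω
  simp [moveFun, edgeGen_mem]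

theorem move_mem_H (s : Gen) : move s ∈ H := Subgroup.subset_closure (mem_range_self s)

theorem move_move (s : Gen) (ω : omegaTau) : move s (move s ω) = ω := moveFun_invol s ω

theorem exists_mem_H_eq_shift_zpow (k : ℤ) (ω : omegaTau) : ∃ h ∈ H, h ω = (shift ^ k) ω := by
  induction k with
  | zero => exact ⟨1, one_mem _, by simp⟩
  | succ k ih =>
    obtain ⟨h, hh, e⟩ := ih
    refine ⟨_, mul_mem (move_mem_H (edgeGen (((shift ^ (k : ℤ)) ω).1 1))) hh, ?_⟩
    rw [add_comm, zpow_add, zpow_one]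
    change move _ (h ω) = shift ((shift ^ (k : ℤ)) ω)
    rw [e, ← shift_eq_move]
  | pred k ih =>
    obtain ⟨h, hh, e⟩ := ih
    set ω' := (shift ^ (-(k : ℤ) - 1)) ω with hω'
    have e1 : shift ω' = (shift ^ (-(k : ℤ))) ω := by
      rw [hω']; change (shift * shift ^ (-(k : ℤ) - 1)) ω = _
      rw [← zpow_one_add]; congr 2; ring
    refine ⟨_, mul_mem (move_mem_H (edgeGen (ω'.1 1))) hh, ?_⟩
    change move _ (h ω) = ω'
    rw [e, ← e1, shift_eq_move, move_move]

/-! ### The isomorphism of Grigorchuk's group with the group of the moves -/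

/-- The boundary point coded by a sequence of the subshift: the Gray code of its phase. -/
noncomputable def code (ω : omegaTau) : Boundary := gray (phase ω)

theorem code_move (s : Gen) (ω : omegaTau) : code (move s ω) = gGen s • code ω := by
  have h := gray_next (isPos_phase ω) s 1
  rw [code, move_eq_shift_zpow, phase_shift_zpow, code]
  push_cast at h ⊢
  rw [add_sub_cancel_right] at h
  rw [← h, add_sub_assoc]

theorem code_surjective : Function.Surjective code := fun ξ => by
  obtain ⟨m, hm⟩ := gray_surjective ξ
  exact ⟨rulerPoint m, by rw [code, phase_rulerPoint, hm]⟩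

theorem closure_range_gGen : Subgroup.closure (range gGen) = ⊤ := by
  rw [eq_top_iff]
  rintro ⟨g, hg⟩ -
  induction hg using Subgroup.closure_induction with
  | mem x hx =>
    obtain ⟨s, rfl⟩ := hx
    exact Subgroup.subset_closure ⟨s, rfl⟩
  | one => exact one_mem (Subgroup.closure (range gGen))
  | mul x y hx hy ihx ihy => exact mul_mem ihx ihy
  | inv x hx ihx => exact inv_mem ihx

theorem eq_of_smul_boundary_eq {g g' : grigorchuk} (h : ∀ ξ : Boundary, g • ξ = g' • ξ) :
    g = g' := by
  refine Subtype.ext (Subtype.ext (Equiv.ext fun w => ?_))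
  obtain ⟨ξ, hξ⟩ : ∃ ξ : Boundary, initial ξ w.length = w := by
    refine ⟨fun n => w.getD n false, List.ext_getElem (by simp [initial]) fun i h1 h2 => ?_⟩
    simp [initial, h2]
  have h1 := initial_boundaryMap g.1 ξ w.length
  have h2 := initial_boundaryMap g'.1 ξ w.length
  have h3 : boundaryMap g.1 ξ = boundaryMap g'.1 ξ := h ξ
  rw [hξ] at h1 h2
  rw [← h1, ← h2, h3]

theorem exists_code_eq_smul {h : omegaTau ≃ₜ omegaTau} (hh : h ∈ H) :
    ∃ g : grigorchuk, ∀ ω, code (h ω) = g • code ω := by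
  induction hh using Subgroup.closure_induction with
  | mem x hx =>
    obtain ⟨s, rfl⟩ := hx
    exact ⟨gGen s, code_move s⟩
  | one => exact ⟨1, fun ω => by rw [one_smul]; rfl⟩
  | mul x y _ _ hx hy =>
    obtain ⟨g, hg⟩ := hx
    obtain ⟨g', hg'⟩ := hy
    exact ⟨g * g', fun ω => by rw [mul_smul, ← hg', ← hg]; rfl⟩
  | inv x _ hx =>
    obtain ⟨g, hg⟩ := hx
    refine ⟨g⁻¹, fun ω => ?_⟩
    rw [eq_inv_smul_iff, ← hg]
    exact congrArg code (x.apply_symm_apply ω)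

theorem eq_of_code_eq_smul {g g' : grigorchuk} {h : omegaTau ≃ₜ omegaTau}
    (hg : ∀ ω, code (h ω) = g • code ω) (hg' : ∀ ω, code (h ω) = g' • code ω) : g = g' :=
  eq_of_smul_boundary_eq fun ξ => by
    obtain ⟨ω, rfl⟩ := code_surjective ξ
    rw [← hg, hg']

/-- The homomorphism from the group of the moves to Grigorchuk's group that makes `code`
equivariant. -/
noncomputable def toGrigorchuk : H →* grigorchuk where
  toFun h := (exists_code_eq_smul h.2).choose
  map_one' := eq_of_code_eq_smul (h := 1) (exists_code_eq_smul (one_mem H)).choose_spec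
    fun ω => by rw [one_smul]; rfl
  map_mul' h h' := eq_of_code_eq_smul (exists_code_eq_smul (h * h').2).choose_spec fun ω => by
    rw [mul_smul, ← (exists_code_eq_smul h'.2).choose_spec,
      ← (exists_code_eq_smul h.2).choose_spec]
    rfl

theorem code_apply (h : H) (ω : omegaTau) : code (h.1 ω) = toGrigorchuk h • code ω :=
  (exists_code_eq_smul h.2).choose_spec ω

theorem toGrigorchuk_move (s : Gen) : toGrigorchuk ⟨move s, move_mem_H s⟩ = gGen s :=
  eq_of_code_eq_smul (code_apply ⟨move s, move_mem_H s⟩) (code_move s)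

theorem mem_range_intCast_of_two_mul {m : ℤ_[2]} {k : ℤ} (h : 2 * m = k) :
    m ∈ range (Int.cast : ℤ → ℤ_[2]) := by
  obtain ⟨j, rfl | rfl⟩ := Int.even_or_odd' k
  · refine ⟨j, mul_left_cancel₀ (two_ne_zero (α := ℤ_[2])) ?_⟩
    rw [h]; push_cast; rfl
  · refine absurd ⟨m, ?_⟩ (not_two_dvd_two_mul_add_one (j : ℤ_[2]))
    rw [h]; push_cast; rfl

/-- At a non-integral phase, integer translates have different codes: the reflection
`m ↦ -1 - m` does not preserve the coset `m + ℤ`. -/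
theorem gray_add_int_eq_iff {m : ℤ_[2]} (hm : m ∉ range (Int.cast : ℤ → ℤ_[2])) (k l : ℤ) :
    gray (m + k) = gray (m + l) ↔ k = l := by
  refine ⟨fun h => ?_, fun h => by rw [h]⟩
  rcases gray_eq_iff.1 h with h | h
  · exact_mod_cast add_left_cancel h
  · refine absurd (mem_range_intCast_of_two_mul (k := -1 - k - l) ?_) hm
    push_cast
    linear_combination h

theorem toGrigorchuk_injective : Function.Injective toGrigorchuk := by
  rw [injective_iff_map_eq_one]
  intro h hh
  refine Subtype.ext (Homeomorph.ext fun ω => ?_)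
  refine congrFun (Continuous.ext_on dense_generic h.1.continuous continuous_id fun ω hω => ?_) ω
  obtain ⟨k, hk⟩ := exists_shift_zpow_eq h.2 ω
  have h1 := code_apply h ω
  rw [hh, one_smul, hk, code, phase_shift_zpow, code] at h1
  have h2 := (gray_add_int_eq_iff hω k 0).1 (by simpa using h1)
  rw [hk, h2]
  simp

theorem toGrigorchuk_surjective : Function.Surjective toGrigorchuk := by
  rw [← MonoidHom.range_eq_top, eq_top_iff, ← closure_range_gGen, Subgroup.closure_le]
  rintro _ ⟨s, rfl⟩
  exact ⟨_, toGrigorchuk_move s⟩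

/-- The isomorphism from Grigorchuk's group to the group of the moves. -/
noncomputable def rho : grigorchuk ≃* H :=
  (MulEquiv.ofBijective toGrigorchuk ⟨toGrigorchuk_injective, toGrigorchuk_surjective⟩).symm

theorem rho_gGen (s : Gen) : (rho (gGen s) : omegaTau ≃ₜ omegaTau) = move s := by
  have : rho (gGen s) = ⟨move s, move_mem_H s⟩ := by
    rw [rho, MulEquiv.symm_apply_eq]
    exact (toGrigorchuk_move s).symm
  rw [this]

theorem range_shift_zpow_eq_range_rho (ω : omegaTau) :
    (range fun n : ℤ => (shift ^ n) ω) =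
      range fun g : grigorchuk => (rho g : omegaTau ≃ₜ omegaTau) ω := by
  ext ω'
  constructor
  · rintro ⟨n, rfl⟩
    obtain ⟨h, hh, e⟩ := exists_mem_H_eq_shift_zpow n ω
    exact ⟨rho.symm ⟨h, hh⟩, by simp [e]⟩
  · rintro ⟨g, rfl⟩
    obtain ⟨k, hk⟩ := exists_shift_zpow_eq (rho g).2 ω
    exact ⟨k, hk.symm⟩

/-! ### Unique ergodicity -/

/-- The homeomorphisms that preserve a measure. -/
def preserving {α : Type*} [TopologicalSpace α] [MeasurableSpace α] [BorelSpace α]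
    (μ : Measure α) : Subgroup (α ≃ₜ α) where
  carrier := {h | μ.map h = μ}
  one_mem' := Measure.map_id
  mul_mem' {g h} hg hh := by
    change μ.map (g ∘ h) = μ
    rw [← Measure.map_map g.measurable h.measurable, hh, hg]
  inv_mem' {h} hh := by
    change μ.map h.symm = μ
    nth_rw 1 [← (hh : μ.map h = μ)]
    rw [Measure.map_map h.symm.measurable h.measurable, h.symm_comp_self, Measure.map_id]

/-- A homeomorphism preserves a measure if it agrees on each piece of a countable partition with a
homeomorphism that preserves the measure: the images of the pieces form a partition again. -/
theorem map_eq_of_piecewise {α ι : Type*} [TopologicalSpace α] [MeasurableSpace α] [BorelSpace α]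
    [Countable ι] [MeasurableSpace ι] [MeasurableSingletonClass ι] {μ : Measure α} {f : α ≃ₜ α}
    {g : ι → α ≃ₜ α} {c : α → ι} (hc : Measurable c) (hf : ∀ x, f x = g (c x) x)
    (hg : ∀ i, μ.map (g i) = μ) : μ.map f = μ := by
  ext A hA
  rw [Measure.map_apply f.measurable hA]
  have hE : ∀ i, MeasurableSet (c ⁻¹' {i}) := fun i => hc (measurableSet_singleton i)
  have hd : Pairwise fun i j => Disjoint (c ⁻¹' {i}) (c ⁻¹' {j}) := fun i j hij =>
    (disjoint_singleton.2 hij).preimage c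
  have hI : ∀ i, MeasurableSet (f.symm ⁻¹' (c ⁻¹' {i})) := fun i => f.symm.measurable (hE i)
  have h1 : μ (f ⁻¹' A) = ∑' i, μ (f ⁻¹' A ∩ c ⁻¹' {i}) := by
    rw [← measure_iUnion (fun i j hij => (hd hij).mono inter_subset_right inter_subset_right)
      fun i => (f.measurable hA).inter (hE i), ← inter_iUnion,
      show ⋃ i, c ⁻¹' {i} = univ by ext; simp, inter_univ]
  have h2 : μ A = ∑' i, μ (A ∩ f.symm ⁻¹' (c ⁻¹' {i})) := by
    rw [← measure_iUnion (fun i j hij => ((hd hij).preimage f.symm).mono inter_subset_right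
      inter_subset_right) fun i => hA.inter (hI i), ← inter_iUnion,
      show ⋃ i, f.symm ⁻¹' (c ⁻¹' {i}) = univ by ext; simp, inter_univ]
  rw [h1, h2]
  refine tsum_congr fun i => ?_
  have h3 : f ⁻¹' A ∩ c ⁻¹' {i} = g i ⁻¹' (A ∩ f.symm ⁻¹' (c ⁻¹' {i})) := by
    ext x
    simp only [mem_inter_iff, mem_preimage, mem_singleton_iff]
    constructor
    · rintro ⟨hA, rfl⟩
      rw [← hf]
      exact ⟨hA, by simp⟩
    · rintro ⟨hA, hx⟩
      have h4 : g i x = f (f.symm (g i x)) := by simp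
      rw [hf, hx] at h4
      rw [← (g i).injective h4] at hx
      exact ⟨by rw [hf, hx]; exact hA, hx⟩
  rw [h3, ← Measure.map_apply (g i).measurable (hA.inter (hI i)), hg]

theorem continuous_coord (n : ℤ) : Continuous fun ω : omegaTau => ω.1 n :=
  (continuous_apply n).comp continuous_subtype_val

theorem map_move_eq_of_map_shift_eq {μ : Measure omegaTau} (h : μ.map shift = μ) (s : Gen) :
    μ.map (move s) = μ := by
  classical
  have hc : Continuous fun ω : omegaTau => next ω.1 s 1 - 1 := by
    have h1 : Continuous fun p : Letter × Letter =>
        (if s ∈ edgeLabels p.1 then 1 + 1 else if s ∈ edgeLabels p.2 then 1 - 1 else 1 : ℤ) - 1 :=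
      continuous_of_discreteTopology
    have h2 : Continuous fun ω : omegaTau => (ω.1 1, ω.1 (1 - 1)) :=
      (continuous_coord 1).prodMk (continuous_coord (1 - 1))
    exact h1.comp h2
  refine map_eq_of_piecewise (g := fun k : ℤ => shift ^ k) hc.measurable
    (fun ω => move_eq_shift_zpow s ω) fun k => ?_
  exact zpow_mem (show shift ∈ preserving μ from h) k

theorem map_shift_eq_of_map_move_eq {μ : Measure omegaTau} (h : ∀ s, μ.map (move s) = μ) :
    μ.map shift = μ := by
  exact map_eq_of_piecewise (g := fun l : Letter => move (edgeGen l))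
    (continuous_coord 1).measurable shift_eq_move fun l => h _

/-- A probability measure on the 2-adic integers that is invariant under adding `1` is the Haar
measure, since the integers are dense. -/
theorem eq_haarInt {ν : Measure ℤ_[2]} [IsProbabilityMeasure ν]
    (h : ν.map (fun z => z + 1) = ν) : ν = haarInt := by
  have hnat : ∀ n : ℕ, ν.map (fun z => z + (n : ℤ_[2])) = ν := by
    intro n
    induction n with
    | zero => simp
    | succ n ih =>
      have e : (fun z : ℤ_[2] => z + ((n + 1 : ℕ) : ℤ_[2])) =
          (fun z => z + 1) ∘ fun z => z + (n : ℤ_[2]) := by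
        funext z; simp [add_assoc]
      rw [e, ← Measure.map_map (by fun_prop) (by fun_prop), ih, h]
  have hinv : ν.IsAddLeftInvariant := by
    refine ⟨fun u => ?_⟩
    have : IsProbabilityMeasure (ν.map (u + ·)) :=
      Measure.isProbabilityMeasure_map (by fun_prop)
    refine ext_of_forall_integral_eq_of_IsFiniteMeasure fun f => ?_
    rw [integral_map (by fun_prop) f.continuous.aestronglyMeasurable]
    have hcont : Continuous fun u : ℤ_[2] => ∫ z, f (u + z) ∂ν := by
      refine continuous_of_dominated (bound := fun _ => ‖f‖) (fun u => ?_) (fun u => ?_)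
        (integrable_const _) (Eventually.of_forall fun z => ?_)
      · exact (f.continuous.comp (continuous_const_add u)).aestronglyMeasurable
      · exact Eventually.of_forall fun z => f.norm_coe_le_norm _
      · exact f.continuous.comp (continuous_add_const z)
    refine congrFun (Continuous.ext_on PadicInt.denseRange_natCast hcont continuous_const ?_) u
    rintro _ ⟨n, rfl⟩
    change ∫ z, f (n + z) ∂ν = ∫ z, f z ∂ν
    nth_rw 2 [← hnat n]
    rw [integral_map (by fun_prop) f.continuous.aestronglyMeasurable]
    simp only [add_comm]
  have : ν.IsAddHaarMeasure := Measure.isAddHaarMeasure_of_isCompact_nonempty_interior ν univ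
    isCompact_univ (by simp) (by simp) (by simp)
  exact Measure.isAddHaarMeasure_eq_of_isProbabilityMeasure _ _

theorem measurable_rulerPoint : Measurable rulerPoint := by
  refine Measurable.subtype_mk (f := rulerSeq) (measurable_pi_lambda _ fun n => ?_)
  refine measurable_to_countable' fun l => ?_
  have h0 : MeasurableSet {m : ℤ_[2] | (n : ℤ_[2]) + m = 0} :=
    (isClosed_singleton.preimage (f := fun m : ℤ_[2] => (n : ℤ_[2]) + m)
      (by fun_prop)).measurableSet
  have h1 : MeasurableSet {m : ℤ_[2] | (n : ℤ_[2]) + m ≠ 0 ∧ Fits l (n + m)} :=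
    ((isOpen_ne_zero_and_fits l).preimage (f := fun m : ℤ_[2] => (n : ℤ_[2]) + m)
      (by fun_prop)).measurableSet
  have e : (fun m => rulerSeq m n) ⁻¹' {l} = {m : ℤ_[2] | (n : ℤ_[2]) + m ≠ 0 ∧ Fits l (n + m)} ∪
      ({m : ℤ_[2] | (n : ℤ_[2]) + m = 0} ∩ {_m | l = .x}) := by
    ext m
    by_cases hm : (n : ℤ_[2]) + m = 0
    · simp [rulerSeq, hm, eq_comm]
    · simp [rulerSeq, hm, fits_of_ne_zero, eq_comm]
  rw [e]
  exact h1.union (h0.inter (MeasurableSet.const _))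

theorem shift_rulerPoint (m : ℤ_[2]) : shift (rulerPoint m) = rulerPoint (m + 1) := by
  refine Subtype.ext (funext fun n => ?_)
  rw [shift_apply]
  change rulerSeq m (n + 1) = rulerSeq (m + 1) n
  have e : ((n + 1 : ℤ) : ℤ_[2]) + m = n + (m + 1) := by push_cast; ring
  unfold rulerSeq
  rw [e]

/-- The invariant measure of the subshift: the image of the Haar measure. -/
noncomputable def subshiftMeasure : Measure omegaTau := haarInt.map rulerPoint

instance : IsProbabilityMeasure subshiftMeasure :=
  Measure.isProbabilityMeasure_map measurable_rulerPoint.aemeasurable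

theorem map_shift_subshiftMeasure : subshiftMeasure.map shift = subshiftMeasure := by
  rw [subshiftMeasure, Measure.map_map shift.measurable measurable_rulerPoint]
  have e : (shift ∘ rulerPoint) = rulerPoint ∘ fun m => m + 1 := funext shift_rulerPoint
  rw [e, ← Measure.map_map measurable_rulerPoint (by fun_prop), map_add_right_eq_self]

theorem eq_subshiftMeasure {ν : Measure omegaTau} [IsProbabilityMeasure ν]
    (h : ν.map shift = ν) : ν = subshiftMeasure := by
  have : IsProbabilityMeasure (ν.map phase) :=
    Measure.isProbabilityMeasure_map continuous_phase.measurable.aemeasurable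
  have hν : ν.map phase = haarInt := by
    refine eq_haarInt ?_
    have e : (fun z => z + 1) ∘ phase = phase ∘ shift := funext fun ω => (phase_shift ω).symm
    rw [Measure.map_map (by fun_prop) continuous_phase.measurable, e,
      ← Measure.map_map continuous_phase.measurable shift.measurable, h]
  -- almost every sequence is generic, hence determined by its phase
  have hae : rulerPoint ∘ phase =ᵐ[ν] id := by
    have h0 : ν (phase ⁻¹' range (Int.cast : ℤ → ℤ_[2])) = 0 := by
      rw [← Measure.map_apply continuous_phase.measurable countable_range_intCast.measurableSet, hν,
        haarInt_of_countable countable_range_intCast]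
    filter_upwards [measure_eq_zero_iff_ae_notMem.1 h0] with ω hω
    exact Subtype.ext ((isPos_rulerSeq _).eq_of_not_int hω (isPos_phase ω))
  rw [subshiftMeasure, ← hν, Measure.map_map measurable_rulerPoint continuous_phase.measurable,
    Measure.map_congr hae, Measure.map_id]

theorem map_rho_eq_of_map_shift_eq {μ : Measure omegaTau} (h : μ.map shift = μ) (g : grigorchuk) :
    μ.map (rho g : omegaTau ≃ₜ omegaTau) = μ := by
  have hH : H ≤ preserving μ := by
    rw [H, Subgroup.closure_le]
    rintro _ ⟨s, rfl⟩
    exact map_move_eq_of_map_shift_eq h s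
  exact hH (rho g).2

theorem map_shift_eq_of_map_rho_eq {μ : Measure omegaTau}
    (h : ∀ g : grigorchuk, μ.map (rho g : omegaTau ≃ₜ omegaTau) = μ) : μ.map shift = μ :=
  map_shift_eq_of_map_move_eq fun s => by rw [← rho_gGen]; exact h _

/-! ### Deterministic rooted graphs -/

/-- In the graph `Γ` every vertex `u` has exactly one edge with label `s`, and it leads to
`f s u`. -/
def RootedGraph.Det (Γ : RootedGraph) (f : Gen → Γ.V → Γ.V) : Prop :=
  ∀ s u v, Γ.Adj s u v ↔ f s u = v

/-- The end point of the walk from `v` along a word of labels. -/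
def run {V : Type*} (f : Gen → V → V) (w : List Gen) (v : V) : V := w.foldl (fun u s => f s u) v

theorem run_concat {V : Type*} (f : Gen → V → V) (w : List Gen) (s : Gen) (v : V) :
    run f (w ++ [s]) v = f s (run f w v) := by simp [run]

theorem run_map {V V' : Type*} {f : Gen → V → V} {f' : Gen → V' → V'} (φ : V → V')
    (h : ∀ s v, φ (f s v) = f' s (φ v)) (w : List Gen) (v : V) :
    φ (run f w v) = run f' w (φ v) := by
  induction w using List.reverseRecOn with
  | nil => rfl
  | append_singleton w s ih => rw [run_concat, run_concat, h, ih]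

/-- Two words of length at most `n` lead to the same vertex for `f` from `v` if and only if they do
so for `f'` from `v'`. -/
def SameRel {V V' : Type*} (n : ℕ) (f : Gen → V → V) (v : V) (f' : Gen → V' → V') (v' : V') :
    Prop :=
  ∀ w w' : List Gen, w.length ≤ n → w'.length ≤ n →
    (run f w v = run f w' v ↔ run f' w v' = run f' w' v')

namespace RootedGraph

variable {Γ Δ Λ : RootedGraph}

theorem ball_mono {m n : ℕ} (h : m ≤ n) : Γ.ball m ⊆ Γ.ball n := by
  induction h with
  | refl => exact Subset.rfl
  | step _ ih => exact fun v hv => Or.inl (ih hv)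

theorem root_mem_ball (n : ℕ) : Γ.root ∈ Γ.ball n := ball_mono (Nat.zero_le n) rfl

theorem exists_mem_ball (v : Γ.V) : ∃ n, v ∈ Γ.ball n := by
  induction Γ.connected v with
  | refl => exact ⟨0, rfl⟩
  | tail _ h ih =>
    obtain ⟨n, hn⟩ := ih
    obtain ⟨s, hs⟩ := h
    exact ⟨n + 1, Or.inr ⟨_, hn, s, hs⟩⟩

theorem Det.mem_ball_iff {f : Gen → Γ.V → Γ.V} (hf : Γ.Det f) {n : ℕ} {v : Γ.V} :
    v ∈ Γ.ball n ↔ ∃ w : List Gen, w.length ≤ n ∧ run f w Γ.root = v := by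
  constructor
  · intro h
    induction n generalizing v with
    | zero => exact ⟨[], by simp, (mem_singleton_iff.1 h).symm⟩
    | succ n ih =>
      rcases h with h | ⟨u, hu, s, hs⟩
      · obtain ⟨w, hw, e⟩ := ih h
        exact ⟨w, by omega, e⟩
      · obtain ⟨w, hw, e⟩ := ih hu
        exact ⟨w ++ [s], by simpa using hw, by rw [run_concat, e, (hf s u v).1 hs]⟩
  · rintro ⟨w, hw, rfl⟩
    refine ball_mono hw ?_
    clear hw
    induction w using List.reverseRecOn with
    | nil => exact root_mem_ball 0
    | append_singleton w s ih =>
      rw [List.length_append]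
      exact Or.inr ⟨_, ih, s, (hf _ _ _).2 (run_concat f w s _).symm⟩

theorem Det.run_mem_ball {f : Gen → Γ.V → Γ.V} (hf : Γ.Det f) {n : ℕ} {w : List Gen}
    (hw : w.length ≤ n) : run f w Γ.root ∈ Γ.ball n := hf.mem_ball_iff.2 ⟨w, hw, rfl⟩

theorem Det.exists_run_eq {f : Gen → Γ.V → Γ.V} (hf : Γ.Det f) (v : Γ.V) :
    ∃ w, run f w Γ.root = v := by
  obtain ⟨n, hn⟩ := exists_mem_ball v
  obtain ⟨w, -, hw⟩ := hf.mem_ball_iff.1 hn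
  exact ⟨w, hw⟩

theorem BallIso.refl (n : ℕ) (Γ : RootedGraph) : BallIso n Γ Γ :=
  ⟨Equiv.refl _, fun _ => Iff.rfl, fun _ _ _ => Iff.rfl⟩

theorem BallIso.symm {n : ℕ} (h : BallIso n Γ Δ) : BallIso n Δ Γ := by
  obtain ⟨e, h0, h1⟩ := h
  exact ⟨e.symm, fun u => by simp [h0], fun s u v => by simp [h1]⟩

theorem BallIso.trans {n : ℕ} (h : BallIso n Γ Δ) (h' : BallIso n Δ Λ) : BallIso n Γ Λ := by
  obtain ⟨e, h0, h1⟩ := h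
  obtain ⟨e', h0', h1'⟩ := h'
  exact ⟨e.trans e', fun u => by simp [h0, h0'], fun s u v => by simp [h1, h1']⟩

theorem Iso.ballIso (h : Iso Γ Δ) (n : ℕ) : BallIso n Γ Δ := by
  obtain ⟨e, h0, h1⟩ := h
  have hmem : ∀ n v, v ∈ Γ.ball n ↔ e v ∈ Δ.ball n := by
    intro n
    induction n with
    | zero => intro v; simp [ball, ← h0]
    | succ n ih =>
      intro v
      refine or_congr (ih v) ⟨?_, ?_⟩
      · rintro ⟨u, hu, s, hs⟩
        exact ⟨e u, (ih u).1 hu, s, (h1 s u v).1 hs⟩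
      · rintro ⟨u, hu, s, hs⟩
        exact ⟨e.symm u, (ih _).2 (by simpa using hu), s, (h1 s _ v).2 (by simpa using hs)⟩
  exact ⟨e.subtypeEquiv (hmem n), fun u => by simp [← h0], fun s u v => h1 s u v⟩

/-- A ball isomorphism maps smaller balls into smaller balls. -/
theorem ballIso_mem_ball {n k : ℕ} (hk : k ≤ n) (e : Γ.ball n ≃ Δ.ball n)
    (h0 : ∀ u : Γ.ball n, (u : Γ.V) = Γ.root ↔ (e u : Δ.V) = Δ.root)
    (h1 : ∀ (s : Gen) (u v : Γ.ball n), Γ.Adj s (u : Γ.V) v ↔ Δ.Adj s (e u : Δ.V) (e v))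
    (u : Γ.ball n) (hu : (u : Γ.V) ∈ Γ.ball k) : (e u : Δ.V) ∈ Δ.ball k := by
  induction k generalizing u with
  | zero => exact (h0 u).1 hu
  | succ k ih =>
    rcases hu with hu | ⟨v, hv, s, hs⟩
    · exact Or.inl (ih (by omega) u hu)
    · let v' : Γ.ball n := ⟨v, ball_mono (by omega) hv⟩
      exact Or.inr ⟨e v', ih (by omega) v' hv, s, (h1 s v' u).1 hs⟩

/-- Being deterministic is a local property. -/
theorem exists_det_of_ballIso (h : ∀ n, ∃ (Δ : RootedGraph) (f : Gen → Δ.V → Δ.V),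
    Δ.Det f ∧ BallIso n Γ Δ) : ∃ f, Γ.Det f := by
  have key : ∀ s u, ∃ v, ∀ v', Γ.Adj s u v' ↔ v = v' := by
    intro s u
    obtain ⟨k, hu⟩ := exists_mem_ball u
    obtain ⟨Δ, f, hf, e, h0, h1⟩ := h (k + 1)
    let u' : Γ.ball (k + 1) := ⟨u, Or.inl hu⟩
    have hv : f s (e u') ∈ Δ.ball (k + 1) :=
      Or.inr ⟨_, ballIso_mem_ball (by omega) e h0 h1 u' hu, s, (hf _ _ _).2 rfl⟩
    refine ⟨e.symm ⟨_, hv⟩, fun v' => ⟨fun hs => ?_, ?_⟩⟩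
    · have h2 := (h1 s u' ⟨v', Or.inr ⟨u, hu, s, hs⟩⟩).1 hs
      rw [hf] at h2
      have h3 : (⟨f s (e u'), hv⟩ : Δ.ball (k + 1)) = e ⟨v', Or.inr ⟨u, hu, s, hs⟩⟩ :=
        Subtype.ext h2
      rw [h3, Equiv.symm_apply_apply]
    · rintro rfl
      refine (h1 s u' (e.symm ⟨_, hv⟩)).2 ?_
      rw [Equiv.apply_symm_apply, hf]
  choose f hf using key
  exact ⟨f, hf⟩

variable {f : Gen → Γ.V → Γ.V} {f' : Gen → Δ.V → Δ.V}

theorem BallIso.sameRel {n : ℕ} (h : BallIso n Γ Δ) (hf : Γ.Det f) (hf' : Δ.Det f') :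
    SameRel n f Γ.root f' Δ.root := by
  obtain ⟨e, h0, h1⟩ := h
  have key : ∀ (w : List Gen) (hw : w.length ≤ n),
      (e ⟨run f w Γ.root, hf.run_mem_ball hw⟩ : Δ.V) = run f' w Δ.root := by
    intro w
    induction w using List.reverseRecOn with
    | nil => exact fun hw => (h0 ⟨Γ.root, _⟩).1 rfl
    | append_singleton w s ih =>
      intro hw
      have hw' : w.length ≤ n := by simp at hw; omega
      have h2 := (h1 s ⟨run f w Γ.root, hf.run_mem_ball hw'⟩
        ⟨run f (w ++ [s]) Γ.root, hf.run_mem_ball hw⟩).1 ((hf _ _ _).2 (run_concat f w s _).symm)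
      rw [hf', ih hw'] at h2
      rw [← h2, run_concat]
  intro w w' hw hw'
  rw [← key w hw, ← key w' hw', Subtype.coe_inj, e.apply_eq_iff_eq, Subtype.mk.injEq]

/-- An edge between vertices of the ball of radius `n` is seen by comparing a walk of length at most
`n + 1` with one of length at most `n`. -/
theorem ballIso_of_sameRel {n : ℕ} (hf : Γ.Det f) (hf' : Δ.Det f')
    (h : SameRel (n + 1) f Γ.root f' Δ.root) : BallIso n Γ Δ := by
  have hch : ∀ u : Γ.ball n, ∃ w : List Gen, w.length ≤ n ∧ run f w Γ.root = u := fun u =>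
    hf.mem_ball_iff.1 u.2
  choose W hW hWu using hch
  let e : Γ.ball n → Δ.ball n := fun u => ⟨run f' (W u) Δ.root, hf'.run_mem_ball (hW u)⟩
  have he : Function.Bijective e := by
    constructor
    · intro u v huv
      have h1 := (h (W u) (W v) ((hW u).trans (by omega)) ((hW v).trans (by omega))).2
        (congrArg Subtype.val huv)
      rw [hWu, hWu] at h1
      exact Subtype.ext h1
    · intro v
      obtain ⟨w, hw, e1⟩ := hf'.mem_ball_iff.1 v.2
      let u : Γ.ball n := ⟨run f w Γ.root, hf.run_mem_ball hw⟩
      refine ⟨u, Subtype.ext ?_⟩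
      rw [← e1]
      exact (h (W u) w ((hW u).trans (by omega)) (by omega)).1 (hWu u)
  refine ⟨Equiv.ofBijective e he, fun u => ?_, fun s u v => ?_⟩
  · have h1 := h (W u) [] ((hW u).trans (by omega)) (by simp)
    rw [hWu] at h1
    exact h1
  · have h1 := h (W u ++ [s]) (W v) (by simpa using hW u) ((hW v).trans (by omega))
    rw [run_concat, run_concat, hWu, hWu] at h1
    rw [hf, hf']
    exact h1

/-- A deterministic rooted graph is determined up to isomorphism by the pairs of words that lead
from the root to the same vertex. -/
theorem iso_of_sameRel (hf : Γ.Det f) (hf' : Δ.Det f')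
    (h : ∀ n, SameRel n f Γ.root f' Δ.root) : Iso Γ Δ := by
  have hr : ∀ w w', run f w Γ.root = run f w' Γ.root ↔ run f' w Δ.root = run f' w' Δ.root :=
    fun w w' => h (max w.length w'.length) w w' (le_max_left _ _) (le_max_right _ _)
  choose W hW using hf.exists_run_eq
  have he : Function.Bijective fun u => run f' (W u) Δ.root := by
    constructor
    · intro u v huv
      have h1 := (hr (W u) (W v)).2 huv
      rwa [hW, hW] at h1
    · intro v
      obtain ⟨w, rfl⟩ := hf'.exists_run_eq v
      exact ⟨run f w Γ.root, (hr _ _).1 (hW _)⟩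
  refine ⟨Equiv.ofBijective _ he, (hr (W Γ.root) []).1 (hW _), fun s u v => ?_⟩
  have h1 := hr (W u ++ [s]) (W v)
  rw [run_concat, run_concat, hW, hW] at h1
  rw [hf, hf']
  exact h1

end RootedGraph

open RootedGraph

theorem cls_eq_cls {Γ Δ : RootedGraph} : cls Γ = cls Δ ↔ Iso Γ Δ := Quotient.eq

theorem exists_cls_eq (x : GraphSpace) : ∃ Γ, cls Γ = x := Quotient.exists_rep x

theorem agreeUpTo_cls {n : ℕ} {Γ Δ : RootedGraph} :
    AgreeUpTo n (cls Γ) (cls Δ) ↔ BallIso n Γ Δ := by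
  constructor
  · rintro ⟨Γ', Δ', h, h', hb⟩
    exact ((cls_eq_cls.1 h).ballIso n).symm.trans (hb.trans ((cls_eq_cls.1 h').ballIso n))
  · exact fun h => ⟨Γ, Δ, rfl, rfl, h⟩

theorem isOpen_agreeUpTo (n : ℕ) (x : GraphSpace) : IsOpen {y | AgreeUpTo n x y} :=
  TopologicalSpace.isOpen_generateFrom_of_mem ⟨x, n, rfl⟩

theorem agreeUpTo_refl (n : ℕ) (x : GraphSpace) : AgreeUpTo n x x := by
  obtain ⟨Γ, rfl⟩ := exists_cls_eq x
  exact agreeUpTo_cls.2 (BallIso.refl n Γ)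

/-! ### The Schreier graphs and the graphs of sequences are deterministic -/

/-- The action of the generators on the orbit of a boundary point. -/
def schreierNext (ξ : Boundary) (s : Gen) (u : (schreier ξ).V) : (schreier ξ).V :=
  ⟨gGen s • (u.1 : Boundary), MulAction.mem_orbit_of_mem_orbit _ u.2⟩

theorem det_schreier (ξ : Boundary) : (schreier ξ).Det (schreierNext ξ) := fun s u v =>
  (Subtype.ext_iff (a1 := schreierNext ξ s u) (a2 := v)).symm

/-- The action of a word of generators on the boundary; the first letter acts first. -/
def act (w : List Gen) (ξ : Boundary) : Boundary := run (fun s ξ => gGen s • ξ) w ξ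

theorem coe_run_schreierNext (ξ : Boundary) (w : List Gen) :
    (run (schreierNext ξ) w (schreier ξ).root).1 = act w ξ :=
  run_map (f' := fun s (ξ : Boundary) => gGen s • ξ) (fun u : (schreier ξ).V => u.1)
    (fun _ _ => rfl) w _

theorem sameRel_schreier {V : Type*} {f : Gen → V → V} {v : V} {ξ : Boundary} {n : ℕ} :
    SameRel n f v (schreierNext ξ) (schreier ξ).root ↔
      ∀ w w' : List Gen, w.length ≤ n → w'.length ≤ n →
        (run f w v = run f w' v ↔ act w ξ = act w' ξ) := by
  refine forall_congr' fun w => forall_congr' fun w' => forall_congr' fun _ =>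
    forall_congr' fun _ => ?_
  rw [← coe_run_schreierNext, ← coe_run_schreierNext]
  exact iff_congr Iff.rfl Subtype.ext_iff

theorem act_reverse (w : List Gen) (ξ : Boundary) : act w.reverse (act w ξ) = ξ := by
  induction w generalizing ξ with
  | nil => rfl
  | cons s w ih =>
    rw [List.reverse_cons, act, run_concat]
    change gGen s • act w.reverse (act w (gGen s • ξ)) = ξ
    rw [ih, gGen_smul_smul]

theorem det_graph (ω : omegaTau) : (graph ω.1).Det (next ω.1) := by
  intro s (n : ℤ) (k : ℤ)
  have halt := omegaTau_alt ω (n - 1)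
  rw [sub_add_cancel] at halt
  have h : (graph ω.1).Adj s n k ↔ (k = n + 1 ∧ s ∈ edgeLabels (ω.1 n)) ∨
      (k = n - 1 ∧ s ∈ edgeLabels (ω.1 (n - 1))) ∨
      (k = n ∧ (s ∈ loopLabels (ω.1 n) ∨ s ∈ loopLabels (ω.1 (n - 1)))) := by
    refine or_congr_right (or_congr ⟨?_, ?_⟩ (and_congr_left' eq_comm))
    · rintro ⟨rfl, h⟩
      exact ⟨by ring, by simpa using h⟩
    · rintro ⟨rfl, h⟩
      exact ⟨by ring, h⟩
  rw [h, next]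
  generalize ω.1 n = p at *
  generalize ω.1 (n - 1) = q at *
  cases p <;> cases q <;> simp [Alt] at halt <;> cases s <;>
    simp [edgeLabels, loopLabels] <;> exact eq_comm

theorem abs_run_next_sub_le (ω : ℤ → Letter) (w : List Gen) (n : ℤ) :
    |run (next ω) w n - n| ≤ w.length := by
  induction w using List.reverseRecOn with
  | nil => simp [run]
  | append_singleton w s ih =>
    rw [run_concat, List.length_append, List.length_singleton]
    rw [abs_le] at ih ⊢
    have h : |next ω s (run (next ω) w n) - run (next ω) w n| ≤ 1 := by
      unfold next; split_ifs <;> simp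
    rw [abs_le] at h
    push_cast
    omega

/-- Walks of length at most `N` from the root see only the letters at `-N, …, N`. -/
theorem run_next_congr {ω ω' : ℤ → Letter} {N : ℕ} (h : ∀ n ∈ Finset.Icc (-N : ℤ) N, ω' n = ω n)
    {w : List Gen} (hw : w.length ≤ N) : run (next ω') w 1 = run (next ω) w 1 := by
  induction w using List.reverseRecOn with
  | nil => rfl
  | append_singleton w s ih =>
    rw [List.length_append, List.length_singleton] at hw
    rw [run_concat, run_concat, ih (by omega)]
    have hb := abs_run_next_sub_le ω w 1
    rw [abs_le] at hb
    have h0 := h (run (next ω) w 1) (by rw [Finset.mem_Icc]; omega)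
    have h1 := h (run (next ω) w 1 - 1) (by rw [Finset.mem_Icc]; omega)
    generalize run (next ω) w 1 = n at h0 h1
    unfold next
    rw [h0, h1]

theorem sameRel_next_congr {V : Type*} {f : Gen → V → V} {v : V} {ω ω' : ℤ → Letter} {N : ℕ}
    (h : ∀ n ∈ Finset.Icc (-N : ℤ) N, ω' n = ω n) :
    SameRel N f v (next ω') 1 ↔ SameRel N f v (next ω) 1 := by
  refine forall_congr' fun w => forall_congr' fun w' => forall_congr' fun hw =>
    forall_congr' fun hw' => ?_
  rw [run_next_congr h hw, run_next_congr h hw']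

theorem continuous_Graph : Continuous fun ω : omegaTau => Graph ω.1 := by
  refine continuous_generateFrom_iff.2 ?_
  rintro _ ⟨x, n, rfl⟩
  rw [isOpen_iff_mem_nhds]
  intro ω hω
  obtain ⟨Γ, rfl⟩ := exists_cls_eq x
  refine mem_of_superset (window_mem_nhds ω (Finset.Icc (-(n + 1 : ℕ) : ℤ) (n + 1 : ℕ)))
    fun ω' h => ?_
  refine agreeUpTo_cls.2 ((agreeUpTo_cls.1 hω).trans
    (ballIso_of_sameRel (det_graph ω) (det_graph ω') ?_))
  exact (sameRel_next_congr h).2 fun _ _ _ _ => Iff.rfl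

theorem gray_run {m : ℤ_[2]} {ω : ℤ → Letter} (h : IsPos m ω) (w : List Gen) :
    gray (m + (run (next ω) w 1 - 1 : ℤ)) = act w (gray m) := by
  have := run_map (f' := fun s (ξ : Boundary) => gGen s • ξ)
    (fun n : ℤ => gray (m + n - 1)) (fun s n => gray_next h s n) w 1
  push_cast at this ⊢
  rw [← add_sub_assoc]
  rw [add_sub_cancel_right] at this
  exact this

/-- At a non-integral phase the graph of the sequence is the orbital Schreier graph of its code. -/
theorem Graph_eq_of_generic {ω : omegaTau} (hω : ω ∈ generic) :
    Graph ω.1 = cls (schreier (code ω)) := by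
  refine cls_eq_cls.2 (iso_of_sameRel (det_graph ω) (det_schreier _) fun n => ?_)
  refine sameRel_schreier.2 fun w w' _ _ => ?_
  change run (next ω.1) w 1 = run (next ω.1) w' 1 ↔ _
  rw [code, ← gray_run (isPos_phase ω), ← gray_run (isPos_phase ω), gray_add_int_eq_iff hω,
    sub_left_inj]

/-! ### The end of the half-line -/

theorem smul_gray_zero {s : Gen} (hs : s ≠ .a) : gGen s • gray 0 = gray 0 :=
  smul_gray_eq_self (fun h => absurd rfl h) fun _ => by
    rw [zero_add]; simpa [rulerLetter, edgeLabels] using hs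

/-- The code of `0` is the only boundary point fixed by `b`, `c` and `d`. -/
theorem eq_gray_zero {ξ : Boundary} (h : ∀ s : Gen, s ≠ .a → gGen s • ξ = ξ) : ξ = gray 0 := by
  obtain ⟨m, rfl⟩ := gray_surjective ξ
  -- by the reflection `m ↦ -1 - m` the number may be assumed even
  obtain ⟨q, hq⟩ : ∃ q, gray m = gray (2 * q) := by
    obtain ⟨q, rfl | rfl⟩ := even_or_odd m
    · exact ⟨q, rfl⟩
    · exact ⟨-1 - q, by rw [← gray_neg_one_sub]; congr 1; ring⟩
  rw [hq] at h ⊢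
  by_contra hne
  have hq0 : q ≠ 0 := fun h0 => hne (by rw [h0, mul_zero])
  have h2 : 2 * q ≠ 0 := mul_ne_zero two_ne_zero hq0
  have hs := edgeGen_mem (rulerLetter (2 * q).valuation)
  have hsa : edgeGen (rulerLetter (2 * q).valuation) ≠ .a := by
    rw [valuation_two_mul hq0] at hs ⊢
    exact ne_a_of_mem_rulerLetter_succ hs
  have h3 := gray_sub_one h2 hs
  rw [h _ hsa, gray_eq_iff] at h3
  rcases h3 with h3 | h3
  · exact one_ne_zero (sub_eq_self.1 h3)
  · refine h2 (mul_left_cancel₀ (two_ne_zero (α := ℤ_[2])) ?_)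
    linear_combination h3

theorem exists_act_gray_natCast (j : ℕ) :
    ∃ w : List Gen, w.length = j ∧ act w (gray j) = gray 0 := by
  induction j with
  | zero => exact ⟨[], rfl, by simp [act, run]⟩
  | succ j ih =>
    obtain ⟨w, hw, e⟩ := ih
    have h := gray_sub_one (m := ((j + 1 : ℕ) : ℤ_[2])) (by exact_mod_cast Nat.succ_ne_zero j)
      (edgeGen_mem _)
    refine ⟨edgeGen (rulerLetter ((j + 1 : ℕ) : ℤ_[2]).valuation) :: w, by simp [hw], ?_⟩
    change act w (gGen _ • gray _) = gray 0
    rw [← h, ← e]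
    congr 2
    push_cast; ring

/-- As long as walks of length at most `n` do not reach the end of the half-line, the graph of a
sequence and the Schreier graph of its code cannot be distinguished by such walks. -/
theorem gray_run_eq_iff {ω : omegaTau} {n : ℕ}
    (h : ∀ w : List Gen, w.length ≤ n → act w (code ω) ≠ gray 0) {w w' : List Gen}
    (hw : w.length ≤ n) (hw' : w'.length ≤ n) :
    act w (code ω) = act w' (code ω) ↔ run (next ω.1) w 1 = run (next ω.1) w' 1 := by
  have hb := abs_run_next_sub_le ω.1 w 1
  have hb' := abs_run_next_sub_le ω.1 w' 1
  rw [abs_le] at hb hb'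
  rw [code] at h ⊢
  rw [← gray_run (isPos_phase ω), ← gray_run (isPos_phase ω)]
  refine ⟨fun e => ?_, fun e => by rw [e]⟩
  rcases gray_eq_iff.1 e with e | e
  · have := add_left_cancel e
    have : run (next ω.1) w 1 - 1 = run (next ω.1) w' 1 - 1 := by exact_mod_cast this
    omega
  · -- a reflection between the end points forces a small integral phase
    exfalso
    obtain ⟨j, hj⟩ := mem_range_intCast_of_two_mul (m := phase ω)
      (k := 1 - run (next ω.1) w 1 - run (next ω.1) w' 1) (by
        push_cast at e ⊢; linear_combination e)
    rw [← hj] at e h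
    have e' : j + (run (next ω.1) w 1 - 1) = -1 - (j + (run (next ω.1) w' 1 - 1)) := by
      exact_mod_cast e
    obtain ⟨i, hi, hin⟩ : ∃ i : ℕ, gray (j : ℤ_[2]) = gray i ∧ i ≤ n := by
      by_cases hj0 : 0 ≤ j
      · obtain ⟨i, rfl⟩ := Int.eq_ofNat_of_zero_le hj0
        exact ⟨i, by simp, by omega⟩
      · obtain ⟨i, hi⟩ := Int.eq_ofNat_of_zero_le (a := -1 - j) (by omega)
        refine ⟨i, ?_, by omega⟩
        rw [← gray_neg_one_sub]
        congr 1
        exact_mod_cast congrArg (Int.cast : ℤ → ℤ_[2]) hi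
    obtain ⟨u, hu, hu0⟩ := exists_act_gray_natCast i
    exact h u (by omega) (by rw [hi, hu0])

/-! ### The closure of the set of Schreier graphs -/

theorem exists_ballIso_of_mem_closure {Γ : RootedGraph} (h : cls Γ ∈ schreierClosure) (n : ℕ) :
    ∃ ξ, BallIso n Γ (schreier ξ) := by
  obtain ⟨_, hy, ξ, rfl⟩ := mem_closure_iff.1 h _ (isOpen_agreeUpTo n _) (agreeUpTo_refl n _)
  exact ⟨ξ, agreeUpTo_cls.1 hy⟩

theorem exists_det_of_mem_closure {Γ : RootedGraph} (h : cls Γ ∈ schreierClosure) :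
    ∃ f, Γ.Det f :=
  exists_det_of_ballIso fun n =>
    let ⟨ξ, hξ⟩ := exists_ballIso_of_mem_closure h n
    ⟨_, _, det_schreier ξ, hξ⟩

/-- A limit of Schreier graphs in which some vertex has loops with labels `b, c, d` is a half-line,
and a word that leads to that vertex determines it. -/
theorem cls_eq_of_end {Γ : RootedGraph} {f : Gen → Γ.V → Γ.V} (h : cls Γ ∈ schreierClosure)
    (hf : Γ.Det f) {w : List Gen}
    (hw : ∀ s : Gen, s ≠ .a → run f (w ++ [s]) Γ.root = run f w Γ.root) :
    cls Γ = cls (schreier (act w.reverse (gray 0))) := by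
  refine cls_eq_cls.2 (iso_of_sameRel hf (det_schreier _) fun n => ?_)
  obtain ⟨ξ, hξ⟩ := exists_ballIso_of_mem_closure h (max n (w.length + 1))
  have hrel := sameRel_schreier.1 (hξ.sameRel hf (det_schreier ξ))
  have hend : act w ξ = gray 0 := eq_gray_zero fun s hs => by
    have := (hrel (w ++ [s]) w (by simp) (by simp)).1 (hw s hs)
    rwa [act, run_concat] at this
  rw [← hend, act_reverse, sameRel_schreier]
  exact fun u u' hu hu' => hrel u u' (hu.trans (le_max_left _ _)) (hu'.trans (le_max_left _ _))

/-- The half-lines are isolated: all nearby limits of Schreier graphs have the end of the half-line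
at the same place, hence coincide with it. -/
theorem notMem_X_of_end {Γ : RootedGraph} {f : Gen → Γ.V → Γ.V} (h : cls Γ ∈ schreierClosure)
    (hf : Γ.Det f) {w : List Gen}
    (hw : ∀ s : Gen, s ≠ .a → run f (w ++ [s]) Γ.root = run f w Γ.root) : cls Γ ∉ X := by
  rintro ⟨-, hiso⟩
  refine hiso ⟨_, isOpen_agreeUpTo (w.length + 1) (cls Γ), ?_⟩
  refine Subset.antisymm ?_ (singleton_subset_iff.2 ⟨agreeUpTo_refl _ _, h⟩)
  rintro y ⟨hy, hyc⟩
  obtain ⟨Δ, rfl⟩ := exists_cls_eq y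
  obtain ⟨f', hf'⟩ := exists_det_of_mem_closure hyc
  have hrel := (agreeUpTo_cls.1 hy).sameRel hf hf'
  rw [mem_singleton_iff, cls_eq_of_end h hf hw]
  exact cls_eq_of_end hyc hf' fun s hs => (hrel _ _ (by simp) (by simp)).1 (hw s hs)

theorem isClosed_sameRel_next {V : Type*} (n : ℕ) (f : Gen → V → V) (v : V) :
    IsClosed {ω : omegaTau | SameRel n f v (next ω.1) 1} := by
  rw [← isOpen_compl_iff, isOpen_iff_mem_nhds]
  intro ω hω
  exact mem_of_superset (window_mem_nhds ω (Finset.Icc (-n : ℤ) n)) fun ω' h h' =>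
    hω ((sameRel_next_congr h).1 h')

/-- Around the root a point of the space of Schreier graphs looks, up to any radius, like the
graph of some sequence; a common limit of these sequences has the given graph. -/
theorem exists_Graph_eq_of_mem_X {x : GraphSpace} (hx : x ∈ X) : ∃ ω : omegaTau, Graph ω.1 = x := by
  obtain ⟨Γ, rfl⟩ := exists_cls_eq x
  obtain ⟨f, hf⟩ := exists_det_of_mem_closure hx.1
  have hend : ∀ w : List Gen, ∃ s : Gen, s ≠ .a ∧ run f (w ++ [s]) Γ.root ≠ run f w Γ.root := by
    by_contra! hcon
    obtain ⟨w, hw⟩ := hcon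
    exact notMem_X_of_end hx.1 hf hw hx
  have hne : ∀ n : ℕ, {ω : omegaTau | SameRel n f Γ.root (next ω.1) 1}.Nonempty := by
    intro n
    obtain ⟨ξ, hξ⟩ := exists_ballIso_of_mem_closure hx.1 (n + 1)
    obtain ⟨ω, rfl⟩ := code_surjective ξ
    have hrel := sameRel_schreier.1 (hξ.sameRel hf (det_schreier _))
    have hω : ∀ w : List Gen, w.length ≤ n → act w (code ω) ≠ gray 0 := by
      intro w hw h0
      obtain ⟨s, hs, hne⟩ := hend w
      refine hne ((hrel (w ++ [s]) w (by simpa using hw) (by omega)).2 ?_)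
      rw [act, run_concat, ← act, h0, smul_gray_zero hs]
    refine ⟨ω, fun w w' hw hw' => ?_⟩
    rw [hrel w w' (by omega) (by omega), gray_run_eq_iff hω hw hw']
  obtain ⟨ω, hω⟩ := IsCompact.nonempty_iInter_of_sequence_nonempty_isCompact_isClosed
    (fun n : ℕ => {ω : omegaTau | SameRel n f Γ.root (next ω.1) 1})
    (fun n ω h w w' hw hw' => h w w' (by omega) (by omega)) hne
    (isClosed_sameRel_next 0 f _).isCompact fun n => isClosed_sameRel_next n f _
  rw [mem_iInter] at hω
  exact ⟨ω, (cls_eq_cls.2 (iso_of_sameRel hf (det_graph ω) hω)).symm⟩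

theorem Graph_mem_schreierClosure (ω : omegaTau) : Graph ω.1 ∈ schreierClosure := by
  refine closure_mono ?_ (image_closure_subset_closure_image continuous_Graph
    (mem_image_of_mem _ (dense_generic ω)))
  rintro _ ⟨ω', hω', rfl⟩
  exact ⟨code ω', (Graph_eq_of_generic hω').symm⟩

/-! ### Reflection and the fibres of the map to graphs -/

theorem fits_neg {l : Letter} {z : ℤ_[2]} : Fits l (-z) ↔ Fits l z := by
  simp [Fits, valuation_neg]

/-- The reflection of a sequence that preserves the root of its graph. -/
def reflect (ω : omegaTau) : omegaTau :=
  ⟨fun n => ω.1 (1 - n), by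
    obtain ⟨m, hm⟩ := exists_isPos ω.2
    refine IsPos.mem_omegaTau (m := -1 - m) fun n => ?_
    have e : (n : ℤ_[2]) + (-1 - m) = -(((1 - n : ℤ) : ℤ_[2]) + m) := by push_cast; ring
    rw [e, fits_neg]
    exact hm (1 - n)⟩

theorem reflect_apply (ω : omegaTau) (n : ℤ) : (reflect ω).1 n = ω.1 (1 - n) := rfl

theorem reflect_ne (ω : omegaTau) : reflect ω ≠ ω := by
  intro h
  have h1 : (reflect ω).1 0 = ω.1 0 := by rw [h]
  rw [reflect_apply, sub_zero] at h1
  have h2 := omegaTau_alt ω 0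
  rw [zero_add, h1, Alt] at h2
  tauto

theorem next_reflect (ω : omegaTau) (s : Gen) (n : ℤ) :
    next (reflect ω).1 s (2 - n) = 2 - next ω.1 s n := by
  have halt := omegaTau_alt ω (n - 1)
  rw [sub_add_cancel] at halt
  have hd := edge_disjoint halt s
  have e1 : (1 : ℤ) - (2 - n) = n - 1 := by ring
  have e2 : (1 : ℤ) - (2 - n - 1) = n := by ring
  unfold next
  rw [reflect_apply, reflect_apply, e1, e2]
  split_ifs with h1 h2 h2
  · exact absurd h2 (hd h1)
  · ring
  · ring
  · rfl

theorem reflect_shift_zpow (k : ℤ) (ω : omegaTau) :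
    reflect ((shift ^ k) ω) = (shift ^ (-k)) (reflect ω) := by
  refine Subtype.ext (funext fun n => ?_)
  rw [reflect_apply, shift_zpow_apply, shift_zpow_apply, reflect_apply]
  exact congrArg ω.1 (by ring)

theorem reflect_move (s : Gen) (ω : omegaTau) : reflect (move s ω) = move s (reflect ω) := by
  have h := next_reflect ω s 1
  rw [move_eq_shift_zpow, move_eq_shift_zpow, reflect_shift_zpow]
  norm_num at h
  rw [h]
  congr 2; ring

theorem reflect_apply_of_mem_H {h : omegaTau ≃ₜ omegaTau} (hh : h ∈ H) (ω : omegaTau) :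
    reflect (h ω) = h (reflect ω) := by
  induction hh using Subgroup.closure_induction generalizing ω with
  | mem x hx =>
    obtain ⟨s, rfl⟩ := hx
    exact reflect_move s ω
  | one => rfl
  | mul x y _ _ hx hy => exact (hx (y ω)).trans (congrArg x (hy ω))
  | inv x _ hx =>
    have h1 := hx (x⁻¹ ω)
    rw [show x (x⁻¹ ω) = ω from x.apply_symm_apply ω] at h1
    rw [h1]
    exact (x.symm_apply_apply _).symm

theorem Graph_reflect (ω : omegaTau) : Graph (reflect ω).1 = Graph ω.1 := by
  refine (cls_eq_cls.2 ⟨(Equiv.subLeft (2 : ℤ) : ℤ ≃ ℤ), rfl, fun s (u : ℤ) (v : ℤ) => ?_⟩).symm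
  refine ((det_graph ω) s u v).trans (Iff.trans ?_ ((det_graph (reflect ω)) s _ _).symm)
  change next ω.1 s u = v ↔ next (reflect ω).1 s (2 - u) = 2 - v
  rw [next_reflect, sub_right_inj]

theorem edgeLabels_injective : Function.Injective edgeLabels := by
  intro p q h
  have h' : ∀ s, s ∈ edgeLabels p ↔ s ∈ edgeLabels q := fun s => by rw [h]
  have ha := h' .a
  have hb := h' .b
  have hc := h' .c
  cases p <;> cases q <;> simp [edgeLabels] at ha hb hc <;> rfl

theorem next_eq_add_one_iff {ω : ℤ → Letter} {s : Gen} {n : ℤ} :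
    next ω s n = n + 1 ↔ s ∈ edgeLabels (ω n) := by
  unfold next
  split_ifs <;> simp_all
  omega

theorem eq_of_next_eq {ω ω' : omegaTau} (h : ∀ s n, next ω.1 s n = next ω'.1 s n) : ω = ω' := by
  refine Subtype.ext (funext fun n => edgeLabels_injective (Set.ext fun s => ?_))
  rw [← next_eq_add_one_iff, ← next_eq_add_one_iff, h]

/-- An injective map of the integers whose steps have length at most one is a translation or a
reflection. -/
theorem int_eq_add_or_sub {e : ℤ → ℤ} (he : Function.Injective e)
    (h : ∀ n, |e (n + 1) - e n| ≤ 1) (a : ℤ) :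
    (∀ n, e n = e a + (n - a)) ∨ ∀ n, e n = e a - (n - a) := by
  have hstep : ∀ n, e (n + 1 + 1) - e (n + 1) = e (n + 1) - e n := by
    intro n
    have h1 := abs_le.1 (h n)
    have h2 := abs_le.1 (h (n + 1))
    have h3 : e (n + 1) ≠ e n := fun h => by have := he h; omega
    have h4 : e (n + 1 + 1) ≠ e (n + 1) := fun h => by have := he h; omega
    have h5 : e (n + 1 + 1) ≠ e n := fun h => by have := he h; omega
    omega
  have hconst : ∀ n, e (n + 1) - e n = e (a + 1) - e a := by
    intro n
    induction n using Int.inductionOn' (b := a) with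
    | zero => rfl
    | succ k _ ih => rw [hstep, ih]
    | pred k _ ih =>
      have := hstep (k - 1)
      rw [sub_add_cancel] at this
      rw [sub_add_cancel, ← this, ih]
  have hlin : ∀ n, e n = e a + (e (a + 1) - e a) * (n - a) := by
    intro n
    induction n using Int.inductionOn' (b := a) with
    | zero => ring
    | succ k _ ih => linear_combination hconst k + ih
    | pred k _ ih =>
      have := hconst (k - 1)
      rw [sub_add_cancel] at this
      linear_combination ih - this
  have h1 := abs_le.1 (h a)
  have h3 : e (a + 1) ≠ e a := fun h => by have := he h; omega
  rcases (by omega : e (a + 1) - e a = 1 ∨ e (a + 1) - e a = -1) with h2 | h2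
  · left; intro n; rw [hlin n, h2]; ring
  · right; intro n; rw [hlin n, h2]; ring

theorem Graph_eq_iff {ω ω' : omegaTau} : Graph ω'.1 = Graph ω.1 ↔ ω' = ω ∨ ω' = reflect ω := by
  constructor
  · intro h
    obtain ⟨e, h0, h1⟩ := cls_eq_cls.1 h.symm
    change ℤ ≃ ℤ at e
    change e 1 = 1 at h0
    have hnext : ∀ s n, e (next ω.1 s n) = next ω'.1 s (e n) := fun s n =>
      (((det_graph ω') s _ _).1 ((h1 s n _).1 (((det_graph ω) s _ _).2 rfl))).symm
    have hstep : ∀ n, |e (n + 1) - e n| ≤ 1 := by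
      intro n
      rw [← next_eq_add_one_iff.2 (edgeGen_mem (ω.1 n)), hnext]
      exact abs_run_next_sub_le ω'.1 [edgeGen (ω.1 n)] (e n)
    rcases int_eq_add_or_sub e.injective hstep 1 with hlin | hlin
    · have hid : ∀ n, e n = n := fun n => by rw [hlin, h0]; ring
      exact Or.inl (eq_of_next_eq fun s n => by
        have := hnext s n
        rw [hid, hid] at this
        exact this.symm)
    · have hre : ∀ n, e n = 2 - n := fun n => by rw [hlin, h0]; ring
      refine Or.inr (eq_of_next_eq fun s n => ?_)
      have h2 := hnext s (2 - n)
      rw [hre, hre, ← next_reflect, sub_sub_cancel] at h2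
      exact h2.symm
  · rintro (rfl | rfl)
    exacts [rfl, Graph_reflect ω]

theorem Graph_mem_X (ω : omegaTau) : Graph ω.1 ∈ X := by
  refine ⟨Graph_mem_schreierClosure ω, ?_⟩
  rintro ⟨U, hU, hUx⟩
  -- an open set of sequences cannot lie in a single fibre, as the fibres have two points
  obtain ⟨m, hm, hmU⟩ := exists_rulerPoint_mem (hU.preimage continuous_Graph)
    ⟨ω, (hUx.symm ▸ mem_singleton _ : Graph ω.1 ∈ U ∩ schreierClosure).1⟩
    (C := {phase ω, phase (reflect ω)}) ((countable_singleton _).insert _)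
  have h1 : Graph (rulerPoint m).1 ∈ U ∩ schreierClosure := ⟨hmU, Graph_mem_schreierClosure _⟩
  rw [hUx, mem_singleton_iff, Graph_eq_iff] at h1
  rcases h1 with h1 | h1
  · exact hm (Or.inl (by rw [← h1, phase_rulerPoint]))
  · exact hm (Or.inr (by rw [mem_singleton_iff, ← h1, phase_rulerPoint]))

/-! ### The space of Schreier graphs as a factor of the subshift -/

/-- The factor map from the subshift to the space of Schreier graphs. -/
def factorMap (ω : omegaTau) : X := ⟨Graph ω.1, Graph_mem_X ω⟩

theorem continuous_factorMap : Continuous factorMap := continuous_Graph.subtype_mk _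

theorem factorMap_surjective : Function.Surjective factorMap := fun x => by
  obtain ⟨ω, hω⟩ := exists_Graph_eq_of_mem_X x.2
  exact ⟨ω, Subtype.ext hω⟩

theorem factorMap_eq_iff {ω ω' : omegaTau} :
    factorMap ω' = factorMap ω ↔ ω' = ω ∨ ω' = reflect ω := by
  rw [← Graph_eq_iff]; exact Subtype.ext_iff

instance : T2Space X := by
  refine ⟨fun x y hxy => ?_⟩
  obtain ⟨ω, rfl⟩ := factorMap_surjective x
  obtain ⟨ω', rfl⟩ := factorMap_surjective y
  obtain ⟨n, hn⟩ : ∃ n, ¬ BallIso n (graph ω.1) (graph ω'.1) := by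
    by_contra! hcon
    exact hxy (Subtype.ext (cls_eq_cls.2 (iso_of_sameRel (det_graph ω) (det_graph ω') fun n =>
      (hcon n).sameRel (det_graph ω) (det_graph ω'))))
  refine ⟨_, _, (isOpen_agreeUpTo n (factorMap ω)).preimage continuous_subtype_val,
    (isOpen_agreeUpTo n (factorMap ω')).preimage continuous_subtype_val, agreeUpTo_refl _ _,
    agreeUpTo_refl _ _, disjoint_left.2 fun z hz hz' => hn ?_⟩
  obtain ⟨Γ, hΓ⟩ := exists_cls_eq z
  rw [mem_preimage, ← hΓ] at hz hz'
  exact (agreeUpTo_cls.1 hz).trans (agreeUpTo_cls.1 hz').symm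

theorem isQuotientMap_factorMap : IsQuotientMap factorMap :=
  continuous_factorMap.isClosedMap.isQuotientMap continuous_factorMap factorMap_surjective

theorem factorMap_rho_eq {ω ω' : omegaTau} (h : factorMap ω' = factorMap ω) (g : grigorchuk) :
    factorMap ((rho g).1 ω') = factorMap ((rho g).1 ω) := by
  rw [factorMap_eq_iff] at h ⊢
  rcases h with rfl | rfl
  · exact Or.inl rfl
  · exact Or.inr (reflect_apply_of_mem_H (rho g).2 ω).symm

/-- The map of the space of Schreier graphs induced by an element of Grigorchuk's group. -/
noncomputable def factorAct (g : grigorchuk) (x : X) : X :=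
  factorMap ((rho g).1 (Function.surjInv factorMap_surjective x))

theorem factorAct_factorMap (g : grigorchuk) (ω : omegaTau) :
    factorAct g (factorMap ω) = factorMap ((rho g).1 ω) :=
  factorMap_rho_eq (Function.surjInv_eq factorMap_surjective _) g

theorem factorAct_mul (g h : grigorchuk) (x : X) :
    factorAct (g * h) x = factorAct g (factorAct h x) := by
  obtain ⟨ω, rfl⟩ := factorMap_surjective x
  rw [factorAct_factorMap, factorAct_factorMap, factorAct_factorMap, map_mul]
  rfl

theorem factorAct_one (x : X) : factorAct 1 x = x := by
  obtain ⟨ω, rfl⟩ := factorMap_surjective x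
  rw [factorAct_factorMap, map_one]
  rfl

theorem continuous_factorAct (g : grigorchuk) : Continuous (factorAct g) := by
  rw [isQuotientMap_factorMap.continuous_iff]
  have : factorAct g ∘ factorMap = factorMap ∘ (rho g).1 := funext (factorAct_factorMap g)
  rw [this]
  exact continuous_factorMap.comp (rho g).1.continuous

/-- The action of Grigorchuk's group on the space of Schreier graphs. -/
noncomputable def factorHom : grigorchuk →* (X ≃ₜ X) where
  toFun g :=
    { toFun := factorAct g
      invFun := factorAct g⁻¹
      left_inv := fun x => by rw [← factorAct_mul, inv_mul_cancel, factorAct_one]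
      right_inv := fun x => by rw [← factorAct_mul, mul_inv_cancel, factorAct_one]
      continuous_toFun := continuous_factorAct g
      continuous_invFun := continuous_factorAct g⁻¹ }
  map_one' := Homeomorph.ext factorAct_one
  map_mul' g h := Homeomorph.ext (factorAct_mul g h)

theorem cls_reroot_graph (ω : omegaTau) (k : ℤ) :
    cls ((graph ω.1).reroot (1 + k : ℤ)) = Graph ((shift ^ k) ω).1 := by
  refine cls_eq_cls.2 ⟨(Equiv.subRight k : ℤ ≃ ℤ), ?_, fun s (u : ℤ) (v : ℤ) => ?_⟩
  · exact add_sub_cancel_right (1 : ℤ) k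
  · refine ((det_graph ω) s u v).trans (Iff.trans ?_ ((det_graph ((shift ^ k) ω)) s _ _).symm)
    change next ω.1 s u = v ↔ next _ s (u - k) = v - k
    have h : next ((shift ^ k) ω).1 s (u - k) = next ω.1 s u - k := by
      have e : u - k - 1 + k = u - 1 := by ring
      unfold next
      rw [shift_zpow_apply, shift_zpow_apply, sub_add_cancel, e]
      split_ifs <;> ring
    rw [h, sub_left_inj]

theorem movesRoot_iff (s : Gen) (ω : omegaTau) (y : GraphSpace) :
    MovesRoot s (Graph ω.1) y ↔ y = Graph (move s ω).1 := by
  have hmove : cls ((graph ω.1).reroot (next ω.1 s 1)) = Graph (move s ω).1 := by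
    rw [move_eq_shift_zpow, ← cls_reroot_graph, add_sub_cancel]
  constructor
  · rintro ⟨Γ, v, hv, hΓ, rfl⟩
    obtain ⟨e, h0, h1⟩ := cls_eq_cls.1 hΓ.symm
    have hev : next ω.1 s 1 = e v := by
      have := (h1 s _ _).1 hv
      rw [h0] at this
      exact (det_graph ω s _ _).1 this
    rw [← hmove, hev]
    exact cls_eq_cls.2 ⟨e, rfl, h1⟩
  · rintro rfl
    exact ⟨graph ω.1, next ω.1 s 1, (det_graph ω s _ _).2 rfl, rfl, hmove.symm⟩

theorem movesRoot_iff_factorHom (s : Gen) (x : X) (y : GraphSpace) :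
    MovesRoot s x y ↔ y = (factorHom (gGen s) x : GraphSpace) := by
  obtain ⟨ω, rfl⟩ := factorMap_surjective x
  have h : (factorHom (gGen s) (factorMap ω) : GraphSpace) = Graph (move s ω).1 := by
    change (factorAct (gGen s) (factorMap ω)).1 = _
    rw [factorAct_factorMap, rho_gGen]
    rfl
  rw [h]
  exact movesRoot_iff s ω y

theorem encard_fiber_factorMap (x : X) : (factorMap ⁻¹' {x}).encard = 2 := by
  obtain ⟨ω, rfl⟩ := factorMap_surjective x
  have : factorMap ⁻¹' {factorMap ω} = {ω, reflect ω} := by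
    ext ω'
    exact factorMap_eq_iff
  rw [this, encard_pair (reflect_ne ω).symm]

end Grig

theorem mainTheorem1 :
    -- (a) the isomorphism `G ≅ H`, i.e. the action of `G` on the subshift
    ∃ ρ : Grig.grigorchuk ≃* Grig.H,
      (∀ s : Grig.Gen, (ρ (Grig.gGen s) : Grig.omegaTau ≃ₜ Grig.omegaTau) = Grig.move s) ∧
      -- (b) `(X, G)`, with `G` acting by changing the root, is a two-to-one factor via `Graph`
      (∃ β : Grig.grigorchuk →* (Grig.X ≃ₜ Grig.X),
        (∀ (s : Grig.Gen) (x : Grig.X) (y : Grig.GraphSpace),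
          Grig.MovesRoot s x y ↔ y = (β (Grig.gGen s) x : Grig.GraphSpace)) ∧
        ∃ ψ : Grig.omegaTau → Grig.X,
          (∀ ω, (ψ ω : Grig.GraphSpace) = Grig.Graph ω) ∧
          Continuous ψ ∧
          Function.Surjective ψ ∧
          (∀ g ω, ψ ((ρ g : Grig.omegaTau ≃ₜ Grig.omegaTau) ω) = β g (ψ ω)) ∧
          ∀ x, (ψ ⁻¹' {x}).encard = 2) ∧
      -- (c) the orbits coincide
      (∀ ω : Grig.omegaTau,
        (Set.range fun n : ℤ => (Grig.shift ^ n) ω) =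
          Set.range fun g : Grig.grigorchuk => (ρ g : Grig.omegaTau ≃ₜ Grig.omegaTau) ω) ∧
      -- (d) unique ergodicity of both systems, with the same invariant measure
      ∃ μ : MeasureTheory.Measure Grig.omegaTau,
        (MeasureTheory.IsProbabilityMeasure μ ∧ μ.map Grig.shift = μ ∧
          ∀ μ' : MeasureTheory.Measure Grig.omegaTau, MeasureTheory.IsProbabilityMeasure μ' →
            μ'.map Grig.shift = μ' → μ' = μ) ∧
        ((∀ g : Grig.grigorchuk,
            μ.map (ρ g : Grig.omegaTau ≃ₜ Grig.omegaTau) = μ) ∧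
          ∀ μ' : MeasureTheory.Measure Grig.omegaTau, MeasureTheory.IsProbabilityMeasure μ' →
            (∀ g : Grig.grigorchuk,
              μ'.map (ρ g : Grig.omegaTau ≃ₜ Grig.omegaTau) = μ') → μ' = μ) := by
  refine ⟨Grig.rho, Grig.rho_gGen, ⟨Grig.factorHom, Grig.movesRoot_iff_factorHom,
    Grig.factorMap, fun _ => rfl, Grig.continuous_factorMap, Grig.factorMap_surjective,
    fun g ω => (Grig.factorAct_factorMap g ω).symm, Grig.encard_fiber_factorMap⟩,
    Grig.range_shift_zpow_eq_range_rho, Grig.subshiftMeasure,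
    ⟨inferInstance, Grig.map_shift_subshiftMeasure, fun _ _ h => Grig.eq_subshiftMeasure h⟩,
    Grig.map_rho_eq_of_map_shift_eq Grig.map_shift_subshiftMeasure,
    fun _ _ h => Grig.eq_subshiftMeasure (Grig.map_shift_eq_of_map_rho_eq h)⟩
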